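/- Let $M$ be a smooth $6$-dimensional manifold (Hausdorff, second countable, without boundary) and let $\omega$ be a smooth $3$-form on $M$ of type $2$, i.e. for every $x\in M$ $$\Delta(\omega_x)=\{v\in T_xM:\ (\iota_v\omega_x)\wedge(\iota_v\omega_x)=0\}=\{0\}.$$ Then there exist two smooth almost complex structures $J_+$ and $J_-$ on $M$ such that (i) $J_++J_-=0$, (ii) $\omega(J_+X_1,X_2,X_3)=\omega(X_1,J_+X_2,X_3)=\omega(X_1,X_2,J_+X_3)$, (iii) $\omega(J_-X_1,X_2,X_3)=\omega(X_1,J_-X_2,X_3)=\omega(X_1,X_2,J_-X_3)$ for all tangent vectors $X_1,X_2,X_3$ at a common point of $M$, if and only if $M$ is orientable. Moreover, for $x\in M$ let $\mathcal J_x\subset\operatorname{End}(T_xM)$ be the linear span of all $J\in\operatorname{End}(T_xM)$ with $J^2=-I$ such that $\omega_x(Jv_1,v_2,v_3)=\omega_x(v_1,Jv_2,v_3)=\omega_x(v_1,v_2,Jv_3)$ for all $v_1,v_2,v_3\in T_xM$. Then $\mathcal J=\bigcup_x\mathcal J_x$ is a smooth subbundle of $\operatorname{End}(TM)$ of rank $1$,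 and it is isomorphic, as a smooth real line bundle, to $\Lambda^6T^*M$. -/

import Mathlib

open scoped Manifold ContDiff Topology

noncomputable section

/-! ### Linear algebra of 3-forms -/

section Linear

variable {V : Type*} [AddCommGroup V] [Module ℝ V] [TopologicalSpace V]

/-- The wedge product of two real alternating forms, as a form whose arguments are indexed by
`Fin p ⊕ Fin q`. Normalisation: sum over `(p, q)`-shuffles. -/
def wedgeForm {p q : ℕ} (α : V [⋀^Fin p]→ₗ[ℝ] ℝ) (β : V [⋀^Fin q]→ₗ[ℝ] ℝ) :
    V [⋀^(Fin p ⊕ Fin q)]→ₗ[ℝ] ℝ :=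
  (LinearMap.mul' ℝ ℝ).compAlternatingMap (α.domCoprod β)

/-- The interior product `ι_v Ω = Ω(v, ·, ·)` of a vector with a 3-form. -/
def interiorForm (v : V) (Ω : V [⋀^Fin 3]→L[ℝ] ℝ) : V [⋀^Fin 2]→ₗ[ℝ] ℝ :=
  Ω.toAlternatingMap.curryLeft v

/-- `Δ(Ω) = {v ∈ V ; (ι_v Ω) ∧ (ι_v Ω) = 0}`. -/
def deltaSet (Ω : V [⋀^Fin 3]→L[ℝ] ℝ) : Set V :=
  {v | wedgeForm (interiorForm v Ω) (interiorForm v Ω) = 0}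

/-- `J² = -I`. -/
def IsComplexStr (J : V →L[ℝ] V) : Prop :=
  ∀ v, J (J v) = -v

/-- The 3-form `Ω` is pure with respect to the endomorphism `J`:
`Ω(J v₁, v₂, v₃) = Ω(v₁, J v₂, v₃) = Ω(v₁, v₂, J v₃)`. -/
def IsPureWrt (Ω : V [⋀^Fin 3]→L[ℝ] ℝ) (J : V →L[ℝ] V) : Prop :=
  ∀ v₁ v₂ v₃ : V,
    Ω ![J v₁, v₂, v₃] = Ω ![v₁, J v₂, v₃] ∧ Ω ![v₁, J v₂, v₃] = Ω ![v₁, v₂, J v₃]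

end Linear

/-! ### 6-dimensional manifolds -/

/-- The model space `ℝ⁶`. -/
abbrev R6 : Type := EuclideanSpace ℝ (Fin 6)

section Manifold

variable {M : Type*} [TopologicalSpace M] [ChartedSpace R6 M]

/-- `M` is orientable: the smooth structure contains an atlas all of whose coordinate changes have
positive Jacobian determinant. -/
def IsOrientable (M : Type*) [TopologicalSpace M] [ChartedSpace R6 M] : Prop :=
  ∃ A : Set (OpenPartialHomeomorph M R6),
    A ⊆ IsManifold.maximalAtlas (𝓡 6) ∞ M ∧
    (∀ x : M, ∃ e ∈ A, x ∈ e.source) ∧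
    ∀ e ∈ A, ∀ e' ∈ A, ∀ x ∈ e.source ∩ e'.source,
      0 < (fderiv ℝ (fun y : R6 => e' (e.symm y)) (e x)).det

variable [IsManifold (𝓡 6) ∞ M]

/-- A field of `k`-forms is smooth on the set `U`: near every point of `U` its expression in the
local trivialisation of `TM` given by the preferred chart at that point is smooth on `U`. -/
def SmoothFormOn {k : ℕ} (η : ∀ x : M, TangentSpace (𝓡 6) x [⋀^Fin k]→L[ℝ] ℝ) (U : Set M) : Prop :=
  ∀ x₀ ∈ U, ContMDiffWithinAt (𝓡 6) 𝓘(ℝ, R6 [⋀^Fin k]→L[ℝ] ℝ) ∞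
    (fun x : M => (η x).compContinuousLinearMap
      ((trivializationAt R6 (TangentSpace (𝓡 6) : M → Type _) x₀).symmL ℝ x)) U x₀

/-- A field of endomorphisms of the tangent spaces (a tensor field of type `(1,1)`) is smooth on
`U`, as a section of the bundle `Hom(TM, TM)`. -/
def SmoothEndOn (A : ∀ x : M, TangentSpace (𝓡 6) x →L[ℝ] TangentSpace (𝓡 6) x) (U : Set M) :
    Prop :=
  ContMDiffOn (𝓡 6) ((𝓡 6).prod 𝓘(ℝ, R6 →L[ℝ] R6)) ∞
    (fun x : M => Bundle.TotalSpace.mk' (R6 →L[ℝ] R6)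
      (E := fun x : M => TangentSpace (𝓡 6) x →L[ℝ] TangentSpace (𝓡 6) x) x (A x)) U

/-- A (smooth) almost complex structure on `M`. -/
def IsAlmostComplex (J : ∀ x : M, TangentSpace (𝓡 6) x →L[ℝ] TangentSpace (𝓡 6) x) : Prop :=
  SmoothEndOn J Set.univ ∧ ∀ x, IsComplexStr (J x)

/-- `Ω` is a (smooth) 3-form of type 2 on `M`: `Δ(Ω_x) = {0}` for every `x`. -/
def IsTypeTwoForm (Ω : ∀ x : M, TangentSpace (𝓡 6) x [⋀^Fin 3]→L[ℝ] ℝ) : Prop :=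
  SmoothFormOn Ω Set.univ ∧ ∀ x, deltaSet (Ω x) = {0}

/-- The subspace of `End(T_xM)` generated by the complex structures on `T_xM` with respect to which
`Ω_x` is pure. -/
def pureSpan (Ω : ∀ x : M, TangentSpace (𝓡 6) x [⋀^Fin 3]→L[ℝ] ℝ) (x : M) :
    Submodule ℝ (TangentSpace (𝓡 6) x →L[ℝ] TangentSpace (𝓡 6) x) :=
  Submodule.span ℝ {J | IsComplexStr J ∧ IsPureWrt (Ω x) J}

/-- A family of subspaces of the `End(T_xM)` is a smooth line subbundle of `End(TM)`: locally it is
spanned by a smooth nowhere vanishing section. -/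
def IsSmoothLineSubbundle
    (L : ∀ x : M, Submodule ℝ (TangentSpace (𝓡 6) x →L[ℝ] TangentSpace (𝓡 6) x)) : Prop :=
  ∀ x₀ : M, ∃ U : Set M, IsOpen U ∧ x₀ ∈ U ∧
    ∃ A : ∀ x : M, TangentSpace (𝓡 6) x →L[ℝ] TangentSpace (𝓡 6) x,
      SmoothEndOn A U ∧ ∀ x ∈ U, A x ≠ 0 ∧ L x = Submodule.span ℝ {A x}

/-- The subbundle `L` of `End(TM)` is isomorphic to `Λ⁶T*M`: there are linear isomorphisms of the
fibres under which the smooth local sections correspond to each other. -/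
def IsIsomorphicToTopForms
    (L : ∀ x : M, Submodule ℝ (TangentSpace (𝓡 6) x →L[ℝ] TangentSpace (𝓡 6) x)) : Prop :=
  ∃ h : ∀ x : M, L x ≃ₗ[ℝ] (TangentSpace (𝓡 6) x [⋀^Fin 6]→L[ℝ] ℝ),
    ∀ (U : Set M), IsOpen U → ∀ A : ∀ x : M, L x,
      (SmoothEndOn (fun x => (A x : TangentSpace (𝓡 6) x →L[ℝ] TangentSpace (𝓡 6) x)) U ↔
        SmoothFormOn (fun x => h x (A x)) U)

end Manifold

end

/-! Hitchin's endomorphism carries the proof. A basis `b` of a 6-dimensional space fixes a volume,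
and up to a constant `K` is determined by `f (K u) = (f ∧ ι_u Ω ∧ Ω)(b)`. Changing `b` multiplies
`K` by a determinant, so identities for `K` may be checked in a basis adapted to the vectors
involved, where they become polynomial identities in the coefficients of `Ω`. They give that `Ω` is
pure for `K` (`triForm_hitchinMap_left`), that `K² = λ` is a scalar
(`exists_hitchinMap_hitchinMap`), and that `Ω(v, w, ·) = 0` makes `v`, `K v`, `w` dependent.

An eigenvector `v` of `K` satisfies `ι_v Ω ∧ ι_v Ω = 0`, because the Pfaffians of `ι_v Ω` are
off-diagonal entries of `K`. For type 2 there is thus no eigenvector, and `λ < 0`. A pure `A`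
satisfies `Ω(v, A v, ·) = 0`, which forces `A = a + cK` (`IsPureEnd.exists_eq`). The pure complex
structures are therefore exactly `± K / √(-λ)`, and they span the line of `K`.

The form `topForm Ω A`, with value `tr(K A)` on `b`, does not depend on a basis. It sends `K` to `6λ
≠ 0`, so it identifies the line with `Λ⁶T*`. As `K` and `λ` are polynomial in `Ω` and `λ` never
vanishes, smooth sections correspond. A global pure `J` is thus a nowhere vanishing 6-form, hence an
orientation. Conversely an orientation selects one of the two signs at each point, and locally the
selected sign is constant. -/

noncomputable section

/-! ### Polynomial identities in the coefficients of a 3-form. -/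

open Module

/-- The entries of Hitchin's endomorphism in terms of the coefficients of the `3`-form. -/
def hitchinEntry (c : Fin 6 → Fin 6 → Fin 6 → ℝ) (j i : Fin 6) : ℝ :=
  (-1) ^ (j : ℕ) * ∑ q : Fin 5, (-1) ^ (q : ℕ) * ∑ r : Fin 4, (-1) ^ (r : ℕ) *
    (c i (j.succAbove q) (j.succAbove (q.succAbove r)) *
      c (j.succAbove (q.succAbove (r.succAbove 0)))
        (j.succAbove (q.succAbove (r.succAbove 1)))
        (j.succAbove (q.succAbove (r.succAbove 2))))

section Coefficients

variable {c : Fin 6 → Fin 6 → Fin 6 → ℝ}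

/-- The function `c` of three indices is alternating. -/
structure IsAlternatingTensor (c : Fin 6 → Fin 6 → Fin 6 → ℝ) : Prop where
  swap₁₂ : ∀ i j k, c j i k = -c i j k
  swap₂₃ : ∀ i j k, c i k j = -c i j k

namespace IsAlternatingTensor

/-- The inequality orients the rewriting: `simp` sorts the indices and stops. -/
theorem sort₁₂ (hc : IsAlternatingTensor c) (i j k : Fin 6) (_ : j < i) :
    c i j k = -c j i k := hc.swap₁₂ _ _ _

theorem sort₂₃ (hc : IsAlternatingTensor c) (i j k : Fin 6) (_ : k < j) :
    c i j k = -c i k j := hc.swap₂₃ _ _ _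

theorem eq_zero₁₂ (hc : IsAlternatingTensor c) (i k : Fin 6) : c i i k = 0 := by
  linarith [hc.swap₁₂ i i k]

theorem eq_zero₂₃ (hc : IsAlternatingTensor c) (i k : Fin 6) : c i k k = 0 := by
  linarith [hc.swap₂₃ i k k]

theorem eq_zero₁₃ (hc : IsAlternatingTensor c) (i k : Fin 6) : c i k i = 0 := by
  rw [hc.swap₂₃, hc.eq_zero₁₂, neg_zero]

/-- The entry evaluates `ι_0 Ω ∧ Ω` on `e₀, e₂, e₃, e₄, e₅`. Since `ι_0 Ω` kills `e₀`, the vector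
`e₀` must go into the second factor, leaving `ι_0 Ω ∧ ι_0 Ω`; each product of the Pfaffian occurs
four times. -/
theorem hitchinEntry_one_zero (hc : IsAlternatingTensor c) :
    hitchinEntry c 1 0 =
      -4 * (c 0 2 3 * c 0 4 5 - c 0 2 4 * c 0 3 5 + c 0 2 5 * c 0 3 4) := by
  simp [hitchinEntry, Fin.sum_univ_succ, Fin.succAbove, hc.eq_zero₁₂,
    hc.eq_zero₁₃, hc.sort₂₃]
  ring

/-- In invariant terms, put `α = ι_v Ω` and `β = ι_w Ω`. Contracting the zero 7-forms `α ∧ α ∧ Ω`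
with `w` and `α ∧ Ω ∧ β` with `v` gives two relations, which combine to `3 ι_w α ∧ α ∧ Ω = 0`, that
is `Ω(K v, v, w) = 0`. -/
theorem sum_hitchinEntry_mul (hc : IsAlternatingTensor c) :
    ∑ l, hitchinEntry c l 0 * c l 0 1 = 0 := by
  simp [hitchinEntry, Fin.sum_univ_succ, Fin.succAbove, hc.eq_zero₁₂, hc.eq_zero₂₃,
    hc.eq_zero₁₃, hc.sort₁₂, hc.sort₂₃]
  ring

/-- An off-diagonal entry of `K²`. For the generic complex form `e¹²³ + e⁴⁵⁶`, `K` acts by opposite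
scalars on the two 3-planes, so `K²` is scalar; the polynomial identity expresses this for all
forms. -/
theorem sum_hitchinEntry_mul_hitchinEntry (hc : IsAlternatingTensor c) :
    ∑ l, hitchinEntry c 1 l * hitchinEntry c l 0 = 0 := by
  simp [hitchinEntry, Fin.sum_univ_succ, Fin.succAbove, hc.eq_zero₁₂, hc.eq_zero₂₃,
    hc.eq_zero₁₃, hc.sort₁₂, hc.sort₂₃]
  ring

end IsAlternatingTensor
end Coefficients

/-! ### Hitchin's endomorphism and its dependence on the basis. -/

section Hitchin

variable {V : Type*} [AddCommGroup V] [Module ℝ V]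

/-- The `3`-form `Ω` as a trilinear map. -/
def triForm (Ω : V [⋀^Fin 3]→ₗ[ℝ] ℝ) : V →ₗ[ℝ] V →ₗ[ℝ] V →ₗ[ℝ] ℝ :=
  LinearMap.mk₂ ℝ
    (fun u x =>
      { toFun := fun y => ((Ω.curryLeft u).curryLeft x).curryLeft y ![]
        map_add' := fun y z => by rw [map_add, AlternatingMap.add_apply]
        map_smul' := fun a y => by rw [map_smul, AlternatingMap.smul_apply, RingHom.id_apply] })
    (fun u u' x => by
      ext y
      simp only [map_add, AlternatingMap.curryLeft_add, LinearMap.add_apply,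
        AlternatingMap.add_apply, LinearMap.coe_mk, AddHom.coe_mk])
    (fun a u x => by
      ext y
      simp only [map_smul, AlternatingMap.curryLeft_smul, LinearMap.smul_apply,
        AlternatingMap.smul_apply, LinearMap.coe_mk, AddHom.coe_mk])
    (fun u x x' => by
      ext y
      simp only [map_add, AlternatingMap.curryLeft_add, LinearMap.add_apply,
        AlternatingMap.add_apply, LinearMap.coe_mk, AddHom.coe_mk])
    (fun a u x => by
      ext y
      simp only [map_smul, AlternatingMap.curryLeft_smul, LinearMap.smul_apply,
        AlternatingMap.smul_apply, LinearMap.coe_mk, AddHom.coe_mk])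

@[simp] theorem triForm_apply (Ω : V [⋀^Fin 3]→ₗ[ℝ] ℝ) (u x y : V) :
    triForm Ω u x y = Ω ![u, x, y] := rfl

theorem triForm_swap₁₂ (Ω : V [⋀^Fin 3]→ₗ[ℝ] ℝ) (u x y : V) :
    triForm Ω x u y = -triForm Ω u x y := by
  have := Ω.map_swap ![u, x, y] (i := 0) (j := 1) (by decide)
  rw [triForm_apply, triForm_apply, ← this]
  congr 1; ext i; fin_cases i <;> simp [Equiv.swap_apply_def]

theorem triForm_swap₂₃ (Ω : V [⋀^Fin 3]→ₗ[ℝ] ℝ) (u x y : V) :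
    triForm Ω u y x = -triForm Ω u x y := by
  have := Ω.map_swap ![u, x, y] (i := 1) (j := 2) (by decide)
  rw [triForm_apply, triForm_apply, ← this]
  congr 1; ext i; fin_cases i <;> simp [Equiv.swap_apply_def]

/-- Wedging linear functionals with `Ω`. -/
def covectorWedge (Ω : V [⋀^Fin 3]→ₗ[ℝ] ℝ) : (V →ₗ[ℝ] ℝ) →ₗ[ℝ] V [⋀^Fin 4]→ₗ[ℝ] ℝ :=
  AlternatingMap.alternatizeUncurryFinLM ∘ₗ LinearMap.smulRightₗ.flip Ω

/-- A multiple of the `5`-form `ι_u Ω ∧ Ω`, as a linear function of `u`. -/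
def interiorWedge (Ω : V [⋀^Fin 3]→ₗ[ℝ] ℝ) : V →ₗ[ℝ] V [⋀^Fin 5]→ₗ[ℝ] ℝ :=
  AlternatingMap.alternatizeUncurryFinLM ∘ₗ (covectorWedge Ω).compRight ℝ ∘ₗ triForm Ω

/-- The `6`-form obtained by antisymmetrizing `Ω(A · , · , · ) Ω( · , · , · )`. -/
def topForm (Ω : V [⋀^Fin 3]→ₗ[ℝ] ℝ) : (V →ₗ[ℝ] V) →ₗ[ℝ] V [⋀^Fin 6]→ₗ[ℝ] ℝ :=
  AlternatingMap.alternatizeUncurryFinLM ∘ₗ (interiorWedge Ω).compRight ℝ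

theorem interiorWedge_apply (Ω : V [⋀^Fin 3]→ₗ[ℝ] ℝ) (u : V) (v : Fin 5 → V) :
    interiorWedge Ω u v = ∑ q : Fin 5, (-1) ^ (q : ℕ) * ∑ r : Fin 4, (-1) ^ (r : ℕ) *
      (triForm Ω u (v q) (v (q.succAbove r)) *
        triForm Ω (v (q.succAbove (r.succAbove 0))) (v (q.succAbove (r.succAbove 1)))
          (v (q.succAbove (r.succAbove 2)))) := by
  simp only [interiorWedge, covectorWedge, LinearMap.comp_apply,
    AlternatingMap.alternatizeUncurryFinLM_apply, AlternatingMap.alternatizeUncurryFin_apply,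
    LinearMap.compRight_apply, triForm_apply]
  refine Finset.sum_congr rfl fun q _ => ?_
  simp only [LinearMap.flip_apply, LinearMap.smulRightₗ_apply, LinearMap.smulRight_apply,
    AlternatingMap.smul_apply, triForm_apply, smul_eq_mul, zsmul_eq_mul, Int.cast_pow,
    Int.cast_neg, Int.cast_one]
  congr 1
  refine Finset.sum_congr rfl fun r _ => ?_
  congr 3
  ext i; fin_cases i <;> rfl

theorem topForm_apply (Ω : V [⋀^Fin 3]→ₗ[ℝ] ℝ) (A : V →ₗ[ℝ] V) (v : Fin 6 → V) :
    topForm Ω A v = ∑ j : Fin 6, (-1) ^ (j : ℕ) *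
      interiorWedge Ω (A (v j)) (v ∘ j.succAbove) := by
  simp [topForm, AlternatingMap.alternatizeUncurryFin_apply]
  rfl

variable (b : Basis (Fin 6) ℝ V)

/-- Hitchin's endomorphism of a `3`-form `Ω`, normalised by the basis `b`:
it is characterised by `f (K u) = (f ∧ ι_u Ω ∧ Ω)(b)` up to a constant. -/
def hitchinMap (Ω : V [⋀^Fin 3]→ₗ[ℝ] ℝ) (b : Basis (Fin 6) ℝ V) : V →ₗ[ℝ] V :=
  { toFun := fun u =>
      ∑ j : Fin 6, ((-1) ^ (j : ℕ) * interiorWedge Ω u (b ∘ j.succAbove)) • b j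
    map_add' := fun u v => by
      simp only [map_add, AlternatingMap.add_apply, mul_add, add_smul, Finset.sum_add_distrib]
    map_smul' := fun a u => by
      simp only [map_smul, AlternatingMap.smul_apply, smul_eq_mul, RingHom.id_apply,
        Finset.smul_sum, smul_smul, mul_left_comm] }

theorem hitchinMap_apply (Ω : V [⋀^Fin 3]→ₗ[ℝ] ℝ) (u : V) :
    hitchinMap Ω b u =
      ∑ j : Fin 6, ((-1) ^ (j : ℕ) * interiorWedge Ω u (b ∘ j.succAbove)) • b j := rfl

theorem apply_hitchinMap (Ω : V [⋀^Fin 3]→ₗ[ℝ] ℝ) (f : V →ₗ[ℝ] ℝ) (u : V) :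
    f (hitchinMap Ω b u) = topForm Ω (f.smulRight u) b := by
  rw [hitchinMap_apply, topForm_apply, map_sum]
  refine Finset.sum_congr rfl fun j _ => ?_
  simp
  ring

/-- The right-hand side is the trace of `K ∘ A`. -/
theorem topForm_apply_basis (Ω : V [⋀^Fin 3]→ₗ[ℝ] ℝ) (A : V →ₗ[ℝ] V) :
    topForm Ω A b = ∑ j, b.coord j (hitchinMap Ω b (A (b j))) := by
  rw [topForm_apply]
  refine Finset.sum_congr rfl fun j _ => ?_
  rw [hitchinMap_apply]
  simp [Finsupp.single_apply]

/-- Each `f (K u)` is the value of a 6-form on the basis, and 6-forms scale by the determinant. -/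
theorem hitchinMap_basis_change (Ω : V [⋀^Fin 3]→ₗ[ℝ] ℝ) (b' : Basis (Fin 6) ℝ V) :
    hitchinMap Ω b' = b.det b' • hitchinMap Ω b := by
  ext u
  refine b.ext_elem fun j => ?_
  change b.coord j _ = b.coord j _
  rw [apply_hitchinMap, LinearMap.smul_apply, map_smul, apply_hitchinMap,
    (topForm Ω ((b.coord j).smulRight u)).eq_smul_basis_det b]
  simp only [AlternatingMap.smul_apply, smul_eq_mul, Basis.det_self]
  ring

/-- The coefficients of `Ω` in the basis `b`. -/
def formCoeff (Ω : V [⋀^Fin 3]→ₗ[ℝ] ℝ) (b : Basis (Fin 6) ℝ V) (i j k : Fin 6) : ℝ :=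
  triForm Ω (b i) (b j) (b k)

theorem isAlternatingTensor_formCoeff (Ω : V [⋀^Fin 3]→ₗ[ℝ] ℝ) :
    IsAlternatingTensor (formCoeff Ω b) :=
  ⟨fun _ _ _ => triForm_swap₁₂ _ _ _ _, fun _ _ _ => triForm_swap₂₃ _ _ _ _⟩

theorem hitchinMap_apply_basis (Ω : V [⋀^Fin 3]→ₗ[ℝ] ℝ) (i : Fin 6) :
    hitchinMap Ω b (b i) = ∑ j, hitchinEntry (formCoeff Ω b) j i • b j := by
  rw [hitchinMap_apply]
  refine Finset.sum_congr rfl fun j _ => ?_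
  rw [interiorWedge_apply]
  rfl

theorem coord_hitchinMap (Ω : V [⋀^Fin 3]→ₗ[ℝ] ℝ) (i j : Fin 6) :
    b.coord j (hitchinMap Ω b (b i)) = hitchinEntry (formCoeff Ω b) j i := by
  rw [hitchinMap_apply_basis]
  simp [Finsupp.single_apply]

end Hitchin

/-! ### Purity for `K`, and `K²` as a scalar. -/

section HitchinIdentities

variable {V : Type*} [AddCommGroup V] [Module ℝ V] (b : Basis (Fin 6) ℝ V)

/-- Places given independent vectors at the first indices, where the coefficient identities are
stated. -/
theorem LinearIndependent.exists_basis_extending {n m : ℕ} {v : Fin n → V}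
    (hv : LinearIndependent ℝ v) (b : Basis (Fin 6) ℝ V) (h : n + m = 6) :
    ∃ b' : Basis (Fin 6) ℝ V, ∀ i, b' (Fin.cast h (Fin.castAdd m i)) = v i := by
  have : Module.Finite ℝ V := Module.Finite.of_basis b
  let B := Basis.sumExtend hv
  have : Finite (Fin n ⊕ Basis.sumExtendIndex hv) := Module.Finite.finite_basis B
  have : Finite (Basis.sumExtendIndex hv) := Finite.sum_right (Fin n)
  have hcard : Nat.card (Basis.sumExtendIndex hv) = m := by
    have h1 := Module.finrank_eq_nat_card_basis B
    rw [Module.finrank_eq_card_basis b, Nat.card_sum, Nat.card_fin, Fintype.card_fin] at h1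
    omega
  let e := (Equiv.sumCongr (Equiv.refl (Fin n)) (Finite.equivFinOfCardEq hcard)).trans
    (finSumFinEquiv.trans (finCongr h))
  refine ⟨B.reindex e, fun i => ?_⟩
  have : e.symm (Fin.cast h (Fin.castAdd m i)) = Sum.inl i := by
    rw [Equiv.symm_apply_eq]; rfl
  rw [Basis.reindex_apply, this]
  simp only [B, Basis.sumExtend, Basis.reindex_apply, Basis.extend_apply_self]
  rfl

theorem triForm_self₂₃ (Ω : V [⋀^Fin 3]→ₗ[ℝ] ℝ) (u x : V) : triForm Ω u x x = 0 := by
  linarith [triForm_swap₂₃ Ω u x x]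

theorem triForm_self₁₂ (Ω : V [⋀^Fin 3]→ₗ[ℝ] ℝ) (u x : V) : triForm Ω u u x = 0 := by
  linarith [triForm_swap₁₂ Ω u u x]

theorem triForm_hitchinMap_self (Ω : V [⋀^Fin 3]→ₗ[ℝ] ℝ) (v w : V) :
    triForm Ω (hitchinMap Ω b v) v w = 0 := by
  by_cases h : LinearIndependent ℝ ![v, w]
  · obtain ⟨b', hb'⟩ := h.exists_basis_extending b (m := 4) rfl
    obtain rfl : b' 0 = v := hb' 0
    obtain rfl : b' 1 = w := hb' 1
    rw [hitchinMap_basis_change b' Ω b, LinearMap.smul_apply, map_smul, LinearMap.smul_apply,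
      LinearMap.smul_apply, hitchinMap_apply_basis]
    simp only [map_sum, LinearMap.sum_apply, map_smul, LinearMap.smul_apply, smul_eq_mul]
    rw [show ∑ j, hitchinEntry (formCoeff Ω b') j 0 * triForm Ω (b' j) (b' 0) (b' 1) = 0 from
      (isAlternatingTensor_formCoeff b' Ω).sum_hitchinEntry_mul, mul_zero]
  · rw [LinearIndependent.pair_iff] at h
    push Not at h
    obtain ⟨s, t, hst, h0⟩ := h
    by_cases ht : t = 0
    · subst ht
      have hs : s ≠ 0 := fun hs => h0 hs rfl
      obtain rfl : v = 0 := by simpa [hs] using hst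
      simp only [map_zero, LinearMap.zero_apply]
    · obtain rfl : w = (-(t⁻¹ * s)) • v := by
        rw [neg_smul, mul_smul, ← smul_neg, eq_inv_smul_iff₀ ht]
        exact eq_neg_of_add_eq_zero_right hst
      rw [map_smul, triForm_self₂₃, smul_zero]

/-- Polarisation of `Ω(K v, v, w) = 0` in `v`. -/
theorem triForm_hitchinMap_left (Ω : V [⋀^Fin 3]→ₗ[ℝ] ℝ) (u v w : V) :
    triForm Ω (hitchinMap Ω b u) v w = triForm Ω u (hitchinMap Ω b v) w := by
  have h := triForm_hitchinMap_self b Ω (u + v) w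
  simp only [map_add, LinearMap.add_apply, triForm_hitchinMap_self, zero_add, add_zero] at h
  rw [triForm_swap₁₂ Ω v] at h
  rw [triForm_swap₁₂ Ω (hitchinMap Ω b v) u]
  linarith [triForm_swap₁₂ Ω v (hitchinMap Ω b u) w]

theorem exists_hitchinMap_hitchinMap (Ω : V [⋀^Fin 3]→ₗ[ℝ] ℝ) :
    ∃ l : ℝ, ∀ v, hitchinMap Ω b (hitchinMap Ω b v) = l • v := by
  -- If `v` and `K² v` were independent, they would be the first two vectors of a basis, and the
  -- vanishing off-diagonal entry would contradict that the second coordinate of `K² v` is 1.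
  have key (v : V) : ¬ LinearIndependent ℝ ![v, (hitchinMap Ω b ∘ₗ hitchinMap Ω b) v] := by
    intro h
    obtain ⟨b', hb'⟩ := h.exists_basis_extending b (m := 4) rfl
    obtain rfl : b' 0 = v := hb' 0
    have h1 : b' 1 = hitchinMap Ω b (hitchinMap Ω b (b' 0)) := hb' 1
    have h2 : b'.coord 1 (b' 1) = 0 := by
      rw [h1, hitchinMap_basis_change b' Ω b, LinearMap.smul_apply, LinearMap.smul_apply,
        map_smul, map_smul, map_smul, hitchinMap_apply_basis]
      simp only [map_sum, map_smul, coord_hitchinMap, smul_eq_mul]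
      simp only [mul_comm (hitchinEntry (formCoeff Ω b') _ 0)]
      rw [(isAlternatingTensor_formCoeff b' Ω).sum_hitchinEntry_mul_hitchinEntry, mul_zero,
        mul_zero]
    simp at h2
  obtain ⟨l, hl⟩ := LinearMap.exists_eq_smul_id_of_forall_notLinearIndependent key
  exact ⟨l, fun v => LinearMap.congr_fun hl v⟩

/-- The Pfaffian of `ι_v Ω` on four vectors. -/
def pfaffian (Ω : V [⋀^Fin 3]→ₗ[ℝ] ℝ) (v x y z w : V) : ℝ :=
  triForm Ω v x y * triForm Ω v z w - triForm Ω v x z * triForm Ω v y w +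
    triForm Ω v x w * triForm Ω v y z

theorem coord_one_hitchinMap (Ω : V [⋀^Fin 3]→ₗ[ℝ] ℝ) :
    b.coord 1 (hitchinMap Ω b (b 0)) = -4 * pfaffian Ω (b 0) (b 2) (b 3) (b 4) (b 5) := by
  rw [coord_hitchinMap, (isAlternatingTensor_formCoeff b Ω).hitchinEntry_one_zero]
  rfl

/-- If `ι_v ι_w Ω = 0`, then `w` is in the span of `v` and `K v`. -/
theorem not_linearIndependent_of_triForm_eq_zero (Ω : V [⋀^Fin 3]→ₗ[ℝ] ℝ) {v w : V}
    (h : ∀ x, triForm Ω v w x = 0) :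
    ¬ LinearIndependent ℝ ![v, hitchinMap Ω b v, w] := by
  intro hli
  obtain ⟨b', hb'⟩ := hli.exists_basis_extending b (m := 3) rfl
  obtain rfl : b' 0 = v := hb' 0
  have h1 : b' 1 = hitchinMap Ω b (b' 0) := hb' 1
  obtain rfl : b' 2 = w := hb' 2
  -- This coordinate of `K v` should be 1, but it is a multiple of a Pfaffian each of whose terms
  -- has a factor `Ω(v, w, ·) = 0`.
  have h2 : b'.coord 1 (b' 1) = 0 := by
    rw [h1, hitchinMap_basis_change b' Ω b, LinearMap.smul_apply, map_smul, coord_one_hitchinMap]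
    simp [pfaffian, -triForm_apply, h]
  simp at h2

end HitchinIdentities

/-! ### Type 2 excludes eigenvectors of `K`. -/

section TypeTwo

variable {V : Type*} [AddCommGroup V] [Module ℝ V]

/-- The factor is `2! · 2!`: the sum runs over all permutations instead of shuffles. -/
theorem four_smul_wedgeForm_apply (α : V [⋀^Fin 2]→ₗ[ℝ] ℝ) (g : Fin 2 ⊕ Fin 2 → V) :
    4 * wedgeForm α α g = ∑ σ : Equiv.Perm (Fin 2 ⊕ Fin 2), ((Equiv.Perm.sign σ : ℤ) : ℝ) *
      (α ![g (σ (.inl 0)), g (σ (.inl 1))] * α ![g (σ (.inr 0)), g (σ (.inr 1))]) := by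
  have h := MultilinearMap.domCoprod_alternization_eq α α
  have h2 : ∀ k : Fin 2 → V, α k = α ![k 0, k 1] := fun k => by
    congr 1; ext i; fin_cases i <;> rfl
  have h3 : wedgeForm α α g = LinearMap.mul' ℝ ℝ (α.domCoprod α g) := rfl
  have h1 : 4 * wedgeForm α α g =
      LinearMap.mul' ℝ ℝ (MultilinearMap.alternatization
        (MultilinearMap.domCoprod (α : MultilinearMap ℝ _ ℝ) (α : MultilinearMap ℝ _ ℝ)) g) := by
    rw [h, AlternatingMap.smul_apply, map_nsmul, ← h3, nsmul_eq_mul]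
    norm_num
  rw [h1, MultilinearMap.alternatization_apply, map_sum]
  refine Finset.sum_congr rfl fun σ _ => ?_
  rw [Units.smul_def, ← zsmul_eq_mul, map_zsmul]
  simp [h2 fun i => g (σ (.inl i)), h2 fun i => g (σ (.inr i))]

/-- The three products of a Pfaffian differ by a relabelling of the slots whose sign matches theirs.
The signed sum of the vanishing Pfaffians is therefore `12` times the wedge. -/
theorem wedgeForm_self_eq_zero (α : V [⋀^Fin 2]→ₗ[ℝ] ℝ) (g : Fin 2 ⊕ Fin 2 → V)
    (h : ∀ σ : Equiv.Perm (Fin 2 ⊕ Fin 2),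
      α ![g (σ (.inl 0)), g (σ (.inl 1))] * α ![g (σ (.inr 0)), g (σ (.inr 1))] -
      α ![g (σ (.inl 0)), g (σ (.inr 0))] * α ![g (σ (.inl 1)), g (σ (.inr 1))] +
      α ![g (σ (.inl 0)), g (σ (.inr 1))] * α ![g (σ (.inl 1)), g (σ (.inr 0))] = 0) :
    wedgeForm α α g = 0 := by
  have h0 := four_smul_wedgeForm_apply α g
  have h1 := Fintype.sum_congr _ _ fun σ : Equiv.Perm (Fin 2 ⊕ Fin 2) =>
    congrArg (((Equiv.Perm.sign σ : ℤ) : ℝ) * ·) (h σ)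
  simp only [mul_add, mul_sub, Finset.sum_add_distrib, Finset.sum_sub_distrib, mul_zero,
    Finset.sum_const_zero] at h1
  have h2 : ∑ σ : Equiv.Perm (Fin 2 ⊕ Fin 2), ((Equiv.Perm.sign σ : ℤ) : ℝ) *
      (α ![g (σ (.inl 0)), g (σ (.inr 0))] * α ![g (σ (.inl 1)), g (σ (.inr 1))]) =
      -(4 * wedgeForm α α g) := by
    rw [h0, ← Finset.sum_neg_distrib]
    refine Fintype.sum_equiv (Equiv.mulRight (Equiv.swap (.inl 1) (.inr 0))) _ _ fun σ => ?_
    simp [Equiv.swap_apply_def]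
  have h3 : ∑ σ : Equiv.Perm (Fin 2 ⊕ Fin 2), ((Equiv.Perm.sign σ : ℤ) : ℝ) *
      (α ![g (σ (.inl 0)), g (σ (.inr 1))] * α ![g (σ (.inl 1)), g (σ (.inr 0))]) =
      4 * wedgeForm α α g := by
    rw [h0]
    refine Fintype.sum_equiv
      (Equiv.mulRight (Equiv.swap (.inr 0) (.inr 1) * Equiv.swap (.inl 1) (.inr 0))) _ _ fun σ => ?_
    simp [Equiv.swap_apply_def]
  rw [h2, h3, ← h0] at h1
  linarith

/-- Purity of a `3`-form with respect to an endomorphism, algebraically. -/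
def IsPureEnd (Ω : V [⋀^Fin 3]→ₗ[ℝ] ℝ) (A : V →ₗ[ℝ] V) : Prop :=
  ∀ u v w, triForm Ω (A u) v w = triForm Ω u (A v) w

/-- The condition `Δ(Ω) = {0}`. -/
def IsTypeTwo (Ω : V [⋀^Fin 3]→ₗ[ℝ] ℝ) : Prop :=
  ∀ v, wedgeForm (Ω.curryLeft v) (Ω.curryLeft v) = 0 → v = 0

variable (b : Basis (Fin 6) ℝ V) {Ω : V [⋀^Fin 3]→ₗ[ℝ] ℝ}

/-- For an eigenvector `v` every off-diagonal coordinate of `K v` vanishes, in any basis starting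
with `v`. Up to a factor these are the Pfaffians of `ι_v Ω`, so `ι_v Ω ∧ ι_v Ω = 0`. -/
theorem IsTypeTwo.hitchinMap_ne_smul (hΩ : IsTypeTwo Ω) {v : V} (hv : v ≠ 0) (a : ℝ) :
    hitchinMap Ω b v ≠ a • v := by
  intro hK
  refine hv (hΩ v ?_)
  obtain ⟨b', hb'⟩ := (LinearIndependent.of_subsingleton (v := ![v]) 0 hv).exists_basis_extending
    b (m := 5) rfl
  obtain rfl : b' 0 = v := hb' 0
  have key (i j k l : Fin 6) (hij : i ≠ j) (hik : i ≠ k) (hil : i ≠ l) (hjk : j ≠ k)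
      (hjl : j ≠ l) (hkl : k ≠ l) : pfaffian Ω (b' 0) (b' i) (b' j) (b' k) (b' l) = 0 := by
    have hz (x : V) : triForm Ω (b' 0) x (b' 0) = 0 := by
      rw [triForm_swap₂₃, triForm_self₁₂, neg_zero]
    by_cases hi : i = 0
    · simp only [pfaffian, hi, triForm_self₁₂]; ring
    by_cases hj : j = 0
    · simp only [pfaffian, hj, triForm_self₁₂, hz]; ring
    by_cases hk : k = 0
    · simp only [pfaffian, hk, triForm_self₁₂, hz]; ring
    by_cases hl : l = 0
    · simp only [pfaffian, hl, hz]; ring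
    obtain ⟨t, ht⟩ : ∃ t, t ∉ ({0, i, j, k, l} : Finset (Fin 6)) := by
      by_contra! h
      have h1 := (Finset.card_eq_iff_eq_univ _).2 (Finset.eq_univ_of_forall h)
      have h2 : ({0, i, j, k, l} : Finset (Fin 6)).card ≤ 5 := Finset.card_le_five
      rw [h1, Fintype.card_fin] at h2
      omega
    simp only [Finset.mem_insert, Finset.mem_singleton, not_or] at ht
    obtain ⟨ht0, hti, htj, htk, htl⟩ := ht
    -- Reordering the basis as `0, t, i, j, k, l`, with `t` the index left over, makes the
    -- coordinate of `K v` at position 1 this Pfaffian.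
    have hinj : Function.Injective ![0, t, i, j, k, l] := by
      simp only [Matrix.vecCons, Fin.cons_injective_iff]
      simp [Ne.symm ht0, Ne.symm hi, Ne.symm hj, Ne.symm hk, Ne.symm hl,
        Function.injective_of_subsingleton]
      exact ⟨⟨htl, htk, htj, hti⟩, ⟨hil, hik, hij⟩, ⟨hjl, hjk⟩, hkl⟩
    let e := Equiv.ofBijective _ (Finite.injective_iff_bijective.1 hinj)
    let b'' := b'.reindex e.symm
    have h3 (m : Fin 6) : b'' m = b' (![0, t, i, j, k, l] m) := by
      simp [b'', e]
    have h4 := coord_one_hitchinMap b'' Ω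
    rw [h3 0, h3 2, h3 3, h3 4, h3 5, hitchinMap_basis_change b Ω b'', LinearMap.smul_apply] at h4
    change _ = -4 * pfaffian Ω (b' 0) (b' i) (b' j) (b' k) (b' l) at h4
    change b''.coord 1 (_ • hitchinMap Ω b (b' 0)) = _ at h4
    rw [hK, show b' 0 = b'' 0 from (h3 0).symm] at h4
    rw [show b' 0 = b'' 0 from (h3 0).symm]
    simp at h4
    exact h4
  refine Basis.ext_alternating b' fun f hf => ?_
  rw [AlternatingMap.zero_apply]
  refine wedgeForm_self_eq_zero _ _ fun σ => ?_
  have hne {x y : Fin 2 ⊕ Fin 2} (hxy : x ≠ y) : f (σ x) ≠ f (σ y) :=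
    fun h => hxy (σ.injective (hf h))
  exact key _ _ _ _ (hne (by decide)) (hne (by decide)) (hne (by decide)) (hne (by decide))
    (hne (by decide)) (hne (by decide))

end TypeTwo

/-! ### Classification of pure endomorphisms. -/

section PureEndomorphisms

variable {V : Type*} [AddCommGroup V] [Module ℝ V] {Ω : V [⋀^Fin 3]→ₗ[ℝ] ℝ}

namespace IsPureEnd

variable {A B : V →ₗ[ℝ] V}

theorem right (hA : IsPureEnd Ω A) (u v w : V) :
    triForm Ω u (A v) w = triForm Ω u v (A w) := by
  have h1 := hA w u v
  rw [triForm_swap₁₂ Ω u (A w) v, triForm_swap₂₃ Ω u v (A w), triForm_swap₁₂ Ω (A u) w v,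
    triForm_swap₂₃ Ω (A u) v w, hA u v w] at h1
  linarith

theorem add (hA : IsPureEnd Ω A) (hB : IsPureEnd Ω B) : IsPureEnd Ω (A + B) := fun u v w => by
  simp only [LinearMap.add_apply, map_add, hA u v w, hB u v w]

theorem smul (hA : IsPureEnd Ω A) (a : ℝ) : IsPureEnd Ω (a • A) := fun u v w => by
  simp only [LinearMap.smul_apply, map_smul, hA u v w]

theorem id : IsPureEnd Ω LinearMap.id := fun _ _ _ => rfl

theorem apply_self (hA : IsPureEnd Ω A) (v x : V) : triForm Ω v (A v) x = 0 := by
  linarith [hA v v x, triForm_swap₁₂ Ω v (A v) x]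

end IsPureEnd

theorem IsTypeTwo.eq_zero (hΩ : IsTypeTwo Ω) {v : V} (h : ∀ x y, triForm Ω v x y = 0) :
    v = 0 := by
  refine hΩ v ?_
  have : Ω.curryLeft v = 0 := by
    ext g
    have := h (g 0) (g 1)
    rw [triForm_apply] at this
    rw [AlternatingMap.zero_apply, ← this]
    change Ω _ = _
    congr 1
    ext i; fin_cases i <;> rfl
  rw [this]
  ext g
  have := four_smul_wedgeForm_apply (0 : V [⋀^Fin 2]→ₗ[ℝ] ℝ) g
  simpa using this

/-- `A` and `B` can be moved to different slots of `Ω` and back in the other order; `Ω` is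
nondegenerate. -/
theorem IsPureEnd.commute (hΩ : IsTypeTwo Ω) {A B : V →ₗ[ℝ] V} (hA : IsPureEnd Ω A)
    (hB : IsPureEnd Ω B) (u : V) : A (B u) = B (A u) := by
  rw [← sub_eq_zero]
  refine hΩ.eq_zero fun v w => ?_
  rw [map_sub, LinearMap.sub_apply, LinearMap.sub_apply, sub_eq_zero, hA, hB, hB.right, ← hA,
    ← hB.right, ← hB]

variable (b : Basis (Fin 6) ℝ V)

theorem isPureEnd_hitchinMap : IsPureEnd Ω (hitchinMap Ω b) := triForm_hitchinMap_left b Ω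

/-- The scalar `λ` with `K² = λ`. -/
def hitchinScalar (Ω : V [⋀^Fin 3]→ₗ[ℝ] ℝ) (b : Basis (Fin 6) ℝ V) : ℝ :=
  topForm Ω (hitchinMap Ω b) b / 6

/-- `topForm Ω K b` is `tr(K²)`, six times the scalar. This formula makes the scalar visibly
polynomial in `Ω`. -/
theorem hitchinMap_hitchinMap (v : V) :
    hitchinMap Ω b (hitchinMap Ω b v) = hitchinScalar Ω b • v := by
  obtain ⟨l, hl⟩ := exists_hitchinMap_hitchinMap b Ω
  have : hitchinScalar Ω b = l := by
    rw [hitchinScalar, topForm_apply_basis]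
    simp [hl]
  rw [hl, this]

/-- If `λ ≥ 0`, then `(K - √λ) v` is nonzero, and it is an eigenvector for `-√λ`. -/
theorem IsTypeTwo.hitchinScalar_neg (hΩ : IsTypeTwo Ω) : hitchinScalar Ω b < 0 := by
  by_contra! h
  have h1 := hΩ.hitchinMap_ne_smul b (b.ne_zero 0) (√(hitchinScalar Ω b))
  refine hΩ.hitchinMap_ne_smul b (sub_ne_zero.2 h1) (-√(hitchinScalar Ω b)) ?_
  rw [map_sub, map_smul, hitchinMap_hitchinMap, smul_sub, smul_smul, neg_mul,
    Real.mul_self_sqrt h]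
  module

theorem IsTypeTwo.coeff_eq_zero (hΩ : IsTypeTwo Ω) {v : V} (hv : v ≠ 0) {a c : ℝ}
    (h : a • v + c • hitchinMap Ω b v = 0) : a = 0 ∧ c = 0 := by
  have hc : c = 0 := by
    by_contra hc
    refine hΩ.hitchinMap_ne_smul b hv (-(c⁻¹ * a)) ?_
    rw [neg_smul, mul_smul, ← smul_neg, eq_inv_smul_iff₀ hc]
    exact eq_neg_of_add_eq_zero_right h
  subst hc
  simpa [hv] using h

theorem IsTypeTwo.exists_eq_of_triForm_eq_zero (hΩ : IsTypeTwo Ω) {v w : V} (hv : v ≠ 0)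
    (h : ∀ x, triForm Ω v w x = 0) : ∃ a c : ℝ, w = a • v + c • hitchinMap Ω b v := by
  have h1 := not_linearIndependent_of_triForm_eq_zero b Ω h
  rw [Fintype.not_linearIndependent_iff] at h1
  obtain ⟨g, hg, i, hi⟩ := h1
  simp only [Fin.sum_univ_three, Matrix.cons_val_zero, Matrix.cons_val_one, Matrix.cons_val] at hg
  by_cases h2 : g 2 = 0
  · rw [h2, zero_smul, add_zero] at hg
    obtain ⟨h3, h4⟩ := hΩ.coeff_eq_zero b hv hg
    fin_cases i <;> simp_all
  · refine ⟨-((g 2)⁻¹ * g 0), -((g 2)⁻¹ * g 1), ?_⟩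
    have h3 : w = (g 2)⁻¹ • (g 2 • w) := by rw [inv_smul_smul₀ h2]
    rw [h3, eq_neg_of_add_eq_zero_right hg]
    module

/-- If `B u ≠ 0`, purity puts `B u` in the span of `v`, `K v`, and `u` in the span of `B u`, `K B
u`. Since `B` commutes with `K` it kills the first span, hence the second, hence `u`. -/
theorem IsPureEnd.eq_zero {B : V →ₗ[ℝ] V} (hB : IsPureEnd Ω B) (b : Basis (Fin 6) ℝ V)
    (hΩ : IsTypeTwo Ω) {v : V}
    (hv : v ≠ 0) (hBv : B v = 0) (u : V) : B u = 0 := by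
  have hcomm := hB.commute hΩ (isPureEnd_hitchinMap b)
  by_contra hz
  have h1 (x : V) : triForm Ω v (B u) x = 0 := by
    rw [← hB, hBv, map_zero, LinearMap.zero_apply, LinearMap.zero_apply]
  obtain ⟨a, c, hac⟩ := hΩ.exists_eq_of_triForm_eq_zero b hv h1
  have h2 (x : V) : triForm Ω (B u) u x = 0 := by
    rw [hB, hB.apply_self]
  obtain ⟨a', c', hu⟩ := hΩ.exists_eq_of_triForm_eq_zero b hz h2
  refine hz ?_
  rw [hu, map_add, map_smul, map_smul, hcomm, hac]
  simp [hcomm, hBv]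

/-- `A v` lies in the span of `v`, `K v` for one `v ≠ 0`; subtracting the matching `a + cK` leaves a
pure endomorphism that kills `v`. -/
theorem IsPureEnd.exists_eq (hΩ : IsTypeTwo Ω) {A : V →ₗ[ℝ] V} (hA : IsPureEnd Ω A) :
    ∃ a c : ℝ, A = a • LinearMap.id + c • hitchinMap Ω b := by
  obtain ⟨a, c, hac⟩ := hΩ.exists_eq_of_triForm_eq_zero b (b.ne_zero 0) (hA.apply_self (b 0))
  refine ⟨a, c, ?_⟩
  have hB := hA.add (((IsPureEnd.id.smul a).add ((isPureEnd_hitchinMap b).smul c)).smul (-1))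
  rw [← sub_eq_zero]
  ext u
  have := hB.eq_zero b hΩ (b.ne_zero 0) (by
    simp only [LinearMap.add_apply, LinearMap.smul_apply, LinearMap.id_apply, hac]; module) u
  rw [LinearMap.zero_apply, ← this]
  simp only [LinearMap.add_apply, LinearMap.sub_apply, LinearMap.smul_apply, LinearMap.id_apply]
  module

theorem IsPureEnd.exists_eq_smul (hΩ : IsTypeTwo Ω) {J : V →ₗ[ℝ] V} (hJ : IsPureEnd Ω J)
    (h : ∀ v, J (J v) = -v) :
    ∃ c : ℝ, J = c • hitchinMap Ω b ∧ c ^ 2 * hitchinScalar Ω b = -1 := by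
  obtain ⟨a, c, rfl⟩ := hJ.exists_eq b hΩ
  have h1 := h (b 0)
  simp only [LinearMap.add_apply, LinearMap.smul_apply, LinearMap.id_apply, map_add, map_smul,
    hitchinMap_hitchinMap] at h1
  -- `(a + cK)² = -1` splits into `a² + c²λ = -1` and `2ac = 0`; `c = 0` would give `a² = -1`.
  obtain ⟨h2, h3⟩ := hΩ.coeff_eq_zero b (b.ne_zero 0) (a := a ^ 2 + c ^ 2 * hitchinScalar Ω b + 1)
    (c := 2 * a * c) (by
      rw [← sub_eq_zero, sub_neg_eq_add] at h1
      rw [← h1]; module)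
  have hc : c ≠ 0 := by
    rintro rfl
    nlinarith
  obtain rfl : a = 0 := by
    simpa [hc] using h3
  exact ⟨c, by simp, by linarith⟩

theorem sq_smul_hitchinMap {c : ℝ} (hc : c ^ 2 * hitchinScalar Ω b = -1) (v : V) :
    (c • hitchinMap Ω b) ((c • hitchinMap Ω b) v) = -v := by
  simp only [LinearMap.smul_apply, map_smul, hitchinMap_hitchinMap, smul_smul]
  rw [← mul_assoc, ← sq, hc, neg_one_smul]

theorem IsTypeTwo.sq_inv_sqrt_mul (hΩ : IsTypeTwo Ω) :
    (√(-hitchinScalar Ω b))⁻¹ ^ 2 * hitchinScalar Ω b = -1 := by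
  have := hΩ.hitchinScalar_neg b
  rw [inv_pow, Real.sq_sqrt (by linarith), inv_mul_eq_div, div_eq_iff (by linarith)]
  ring

end PureEndomorphisms

/-! ### Naturality under linear maps. -/

section Transport

variable {V W : Type*} [AddCommGroup V] [Module ℝ V] [AddCommGroup W] [Module ℝ W]

theorem triForm_compLinearMap (Ω : V [⋀^Fin 3]→ₗ[ℝ] ℝ) (e : W →ₗ[ℝ] V) (x y z : W) :
    triForm (Ω.compLinearMap e) x y z = triForm Ω (e x) (e y) (e z) := by
  simp only [triForm_apply, AlternatingMap.compLinearMap_apply]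
  congr 1
  ext i; fin_cases i <;> rfl

theorem interiorWedge_compLinearMap (Ω : V [⋀^Fin 3]→ₗ[ℝ] ℝ) (e : W →ₗ[ℝ] V) (u : W)
    (v : Fin 5 → W) :
    interiorWedge (Ω.compLinearMap e) u v = interiorWedge Ω (e u) (e ∘ v) := by
  simp only [interiorWedge_apply, triForm_compLinearMap, Function.comp_apply]

theorem topForm_compLinearMap (Ω : V [⋀^Fin 3]→ₗ[ℝ] ℝ) (e : W →ₗ[ℝ] V) (A : V →ₗ[ℝ] V)
    (B : W →ₗ[ℝ] W) (h : ∀ w, e (B w) = A (e w)) (v : Fin 6 → W) :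
    topForm (Ω.compLinearMap e) B v = topForm Ω A (e ∘ v) := by
  simp only [topForm_apply, interiorWedge_compLinearMap, h, Function.comp_apply,
    Function.comp_assoc]

theorem hitchinMap_compLinearMap (Ω : V [⋀^Fin 3]→ₗ[ℝ] ℝ) (e : W ≃ₗ[ℝ] V)
    (b : Basis (Fin 6) ℝ W) (w : W) :
    e (hitchinMap (Ω.compLinearMap (e : W →ₗ[ℝ] V)) b w) = hitchinMap Ω (b.map e) (e w) := by
  simp only [hitchinMap_apply, interiorWedge_compLinearMap, map_sum, map_smul, Basis.map_apply]
  rfl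

end Transport

/-! ### The pure line and its isomorphism with the 6-forms. -/

section ContinuousForms

variable {V : Type*} [AddCommGroup V] [Module ℝ V] [TopologicalSpace V]

theorem isPureWrt_iff {Ω : V [⋀^Fin 3]→L[ℝ] ℝ} {J : V →L[ℝ] V} :
    IsPureWrt Ω J ↔ IsPureEnd Ω.toAlternatingMap (J : V →ₗ[ℝ] V) :=
  ⟨fun h u v w => (h u v w).1, fun h u v w => ⟨h u v w, h.right u v w⟩⟩

theorem isTypeTwo_of_deltaSet {Ω : V [⋀^Fin 3]→L[ℝ] ℝ} (h : deltaSet Ω = {0}) :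
    IsTypeTwo Ω.toAlternatingMap := fun v hv => by
  have : v ∈ deltaSet Ω := hv
  rwa [h] at this

theorem topForm_hitchinMap_self {Ω : V [⋀^Fin 3]→L[ℝ] ℝ} (b : Basis (Fin 6) ℝ V) :
    topForm Ω.toAlternatingMap (hitchinMap Ω.toAlternatingMap b) b =
      6 * hitchinScalar Ω.toAlternatingMap b := by
  rw [hitchinScalar]; ring

variable [IsTopologicalAddGroup V] [ContinuousSMul ℝ V] [T2Space V] (b : Basis (Fin 6) ℝ V)

/-- The determinant with respect to a basis, as a continuous alternating map. -/
def Module.Basis.detL : V [⋀^Fin 6]→L[ℝ] ℝ :=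
  { b.det with
    cont := by
      have : FiniteDimensional ℝ V := Module.Finite.of_basis b
      change Continuous fun v : Fin 6 → V => b.det v
      simp only [Basis.det_apply]
      refine Continuous.matrix_det (continuous_pi fun i => continuous_pi fun j => ?_)
      exact ((b.coord i).continuous_of_finiteDimensional).comp (continuous_apply j) }

@[simp] theorem Module.Basis.detL_apply (v : Fin 6 → V) : b.detL v = b.det v := rfl

theorem ContinuousAlternatingMap.eq_smul_detL (η : V [⋀^Fin 6]→L[ℝ] ℝ) : η = η b • b.detL := by
  ext v
  have := DFunLike.congr_fun (η.toAlternatingMap.eq_smul_basis_det b) v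
  exact this

/-- The endomorphism `hitchinMap` as a continuous linear map. -/
def hitchinMapL (Ω : V [⋀^Fin 3]→L[ℝ] ℝ) (b : Basis (Fin 6) ℝ V) : V →L[ℝ] V :=
  ⟨hitchinMap Ω.toAlternatingMap b, by
    have : FiniteDimensional ℝ V := Module.Finite.of_basis b
    exact LinearMap.continuous_of_finiteDimensional _⟩

@[simp] theorem coe_hitchinMapL (Ω : V [⋀^Fin 3]→L[ℝ] ℝ) :
    (hitchinMapL Ω b : V →ₗ[ℝ] V) = hitchinMap Ω.toAlternatingMap b := rfl

theorem hitchinMapL_apply (Ω : V [⋀^Fin 3]→L[ℝ] ℝ) (v : V) :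
    hitchinMapL Ω b v = hitchinMap Ω.toAlternatingMap b v := rfl

variable {Ω : V [⋀^Fin 3]→L[ℝ] ℝ}

/-- The complex structures for which `Ω` is pure. -/
theorem isComplexStr_and_isPureWrt_iff (hΩ : IsTypeTwo Ω.toAlternatingMap) {J : V →L[ℝ] V} :
    IsComplexStr J ∧ IsPureWrt Ω J ↔
      ∃ c : ℝ, J = c • hitchinMapL Ω b ∧ c ^ 2 * hitchinScalar Ω.toAlternatingMap b = -1 := by
  rw [isPureWrt_iff]
  constructor
  · rintro ⟨h1, h2⟩
    obtain ⟨c, hc, hc'⟩ := h2.exists_eq_smul b hΩ h1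
    exact ⟨c, ContinuousLinearMap.coe_injective hc, hc'⟩
  · rintro ⟨c, rfl, hc⟩
    exact ⟨sq_smul_hitchinMap b hc, (isPureEnd_hitchinMap b).smul c⟩

theorem span_pure_eq (hΩ : IsTypeTwo Ω.toAlternatingMap) :
    Submodule.span ℝ {J | IsComplexStr J ∧ IsPureWrt Ω J} =
      Submodule.span ℝ {hitchinMapL Ω b} := by
  apply le_antisymm
  · rw [Submodule.span_le]
    intro J hJ
    obtain ⟨c, rfl, -⟩ := (isComplexStr_and_isPureWrt_iff b hΩ).1 hJ
    exact Submodule.smul_mem _ _ (Submodule.mem_span_singleton_self _)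
  · rw [Submodule.span_singleton_le_iff_mem]
    have hc := hΩ.sq_inv_sqrt_mul b
    set c := (√(-hitchinScalar Ω.toAlternatingMap b))⁻¹
    have hc0 : c ≠ 0 := by
      intro h
      rw [h] at hc
      norm_num at hc
    rw [← inv_smul_smul₀ hc0 (hitchinMapL Ω b)]
    exact Submodule.smul_mem _ _ (Submodule.subset_span
      ((isComplexStr_and_isPureWrt_iff b hΩ).2 ⟨c, rfl, hc⟩))

/-- The linear map `A ↦ topForm Ω A` with values in continuous alternating maps. -/
def topFormL (Ω : V [⋀^Fin 3]→L[ℝ] ℝ) (b : Basis (Fin 6) ℝ V) :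
    (V →L[ℝ] V) →ₗ[ℝ] V [⋀^Fin 6]→L[ℝ] ℝ where
  toFun A := topForm Ω.toAlternatingMap (A : V →ₗ[ℝ] V) b • b.detL
  map_add' A B := by
    rw [ContinuousLinearMap.toLinearMap_add, map_add, AlternatingMap.add_apply, add_smul]
  map_smul' a A := by
    rw [ContinuousLinearMap.toLinearMap_smul, map_smul, AlternatingMap.smul_apply, smul_assoc,
      RingHom.id_apply]

theorem topFormL_apply (A : V →L[ℝ] V) (v : Fin 6 → V) :
    topFormL Ω b A v = topForm Ω.toAlternatingMap (A : V →ₗ[ℝ] V) v := by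
  have := DFunLike.congr_fun
    ((topForm Ω.toAlternatingMap (A : V →ₗ[ℝ] V)).eq_smul_basis_det b) v
  exact this.symm

theorem topFormL_hitchinMapL :
    topFormL Ω b (hitchinMapL Ω b) = (6 * hitchinScalar Ω.toAlternatingMap b) • b.detL := by
  rw [← topForm_hitchinMap_self]
  rfl

/-- If `A` is a multiple of `hitchinMap`, the factor is a quotient of values of `topForm`. -/
theorem eq_smul_hitchinMapL (hΩ : IsTypeTwo Ω.toAlternatingMap) {A : V →L[ℝ] V}
    (hA : A ∈ Submodule.span ℝ {hitchinMapL Ω b}) :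
    A = (topForm Ω.toAlternatingMap (A : V →ₗ[ℝ] V) b /
      (6 * hitchinScalar Ω.toAlternatingMap b)) • hitchinMapL Ω b := by
  obtain ⟨a, rfl⟩ := Submodule.mem_span_singleton.1 hA
  have h := hΩ.hitchinScalar_neg b
  rw [ContinuousLinearMap.toLinearMap_smul, map_smul, AlternatingMap.smul_apply, coe_hitchinMapL,
    topForm_hitchinMap_self, smul_eq_mul, mul_div_cancel_right₀]
  simp [h.ne]

/-- The isomorphism of the line of pure endomorphisms with the top-degree forms. -/
def spanPureEquiv (hΩ : IsTypeTwo Ω.toAlternatingMap) :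
    Submodule.span ℝ {J | IsComplexStr J ∧ IsPureWrt Ω J} ≃ₗ[ℝ] V [⋀^Fin 6]→L[ℝ] ℝ :=
  LinearEquiv.ofBijective ((topFormL Ω b).domRestrict _) <| by
    have h := hΩ.hitchinScalar_neg b
    constructor
    · rw [injective_iff_map_eq_zero]
      rintro ⟨A, hA⟩ h0
      rw [span_pure_eq b hΩ] at hA
      have h1 : topForm Ω.toAlternatingMap (A : V →ₗ[ℝ] V) b = 0 := by
        rw [← topFormL_apply b]
        exact congrArg (fun η : V [⋀^Fin 6]→L[ℝ] ℝ => η b) h0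
      ext1
      change A = 0
      rw [eq_smul_hitchinMapL b hΩ hA, h1, zero_div, zero_smul]
    · intro η
      refine ⟨⟨(η b / (6 * hitchinScalar Ω.toAlternatingMap b)) • hitchinMapL Ω b, ?_⟩, ?_⟩
      · rw [span_pure_eq b hΩ]
        exact Submodule.smul_mem _ _ (Submodule.mem_span_singleton_self _)
      · refine Eq.trans ?_ (η.eq_smul_detL b).symm
        rw [LinearMap.domRestrict_apply, map_smul, topFormL_hitchinMapL, smul_smul,
          div_mul_cancel₀]
        simp [h.ne]

theorem spanPureEquiv_apply (hΩ : IsTypeTwo Ω.toAlternatingMap)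
    (A : Submodule.span ℝ {J | IsComplexStr J ∧ IsPureWrt Ω J}) (v : Fin 6 → V) :
    spanPureEquiv b hΩ A v =
      topForm Ω.toAlternatingMap ((A : V →L[ℝ] V) : V →ₗ[ℝ] V) v :=
  topFormL_apply b (A : V →L[ℝ] V) v

end ContinuousForms

/-! ### Smooth dependence of `K` and `λ` on the form. -/

section SmoothDependence

/-- The standard basis of the model space. -/
def stdBasis : Basis (Fin 6) ℝ R6 := (EuclideanSpace.basisFun (Fin 6) ℝ).toBasis

theorem contDiff_triForm (u x y : R6) :
    ContDiff ℝ ∞ fun Ω : R6 [⋀^Fin 3]→L[ℝ] ℝ => triForm Ω.toAlternatingMap u x y :=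
  (ContinuousAlternatingMap.apply ℝ R6 ℝ ![u, x, y]).contDiff

theorem contDiff_interiorWedge (u : R6) (v : Fin 5 → R6) :
    ContDiff ℝ ∞ fun Ω : R6 [⋀^Fin 3]→L[ℝ] ℝ => interiorWedge Ω.toAlternatingMap u v := by
  simp only [interiorWedge_apply]
  refine ContDiff.sum fun q _ => contDiff_const.mul (ContDiff.sum fun r _ => contDiff_const.mul ?_)
  exact (contDiff_triForm _ _ _).mul (contDiff_triForm _ _ _)

theorem contDiff_hitchinMapL :
    ContDiff ℝ ∞ fun Ω : R6 [⋀^Fin 3]→L[ℝ] ℝ => hitchinMapL Ω stdBasis := by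
  rw [contDiff_clm_apply_iff]
  intro u
  simp only [hitchinMapL_apply, hitchinMap_apply]
  exact ContDiff.sum fun j _ =>
    (contDiff_const.mul (contDiff_interiorWedge _ _)).smul contDiff_const

theorem contDiff_topForm :
    ContDiff ℝ ∞ fun p : (R6 [⋀^Fin 3]→L[ℝ] ℝ) × (R6 →L[ℝ] R6) =>
      topForm p.1.toAlternatingMap (p.2 : R6 →ₗ[ℝ] R6) stdBasis := by
  simp only [topForm_apply_basis]
  refine ContDiff.sum fun j _ => ?_
  exact (LinearMap.toContinuousLinearMap (stdBasis.coord j)).contDiff.comp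
    ((contDiff_hitchinMapL.comp contDiff_fst).clm_apply (contDiff_snd.clm_apply contDiff_const))

theorem contDiff_hitchinScalar :
    ContDiff ℝ ∞ fun Ω : R6 [⋀^Fin 3]→L[ℝ] ℝ => hitchinScalar Ω.toAlternatingMap stdBasis :=
  (contDiff_topForm.comp (contDiff_id.prodMk contDiff_hitchinMapL)).div_const 6

end SmoothDependence

/-! ### Expressions in the trivialisations of the tangent bundle. -/

section Manifold

variable {M : Type*} [TopologicalSpace M] [ChartedSpace R6 M] [IsManifold (𝓡 6) ∞ M]

/-- The expression of a form in the trivialisation of the tangent bundle at `x₀`. -/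
def formInCoord {k : ℕ} (η : ∀ x : M, TangentSpace (𝓡 6) x [⋀^Fin k]→L[ℝ] ℝ) (x₀ x : M) :
    R6 [⋀^Fin k]→L[ℝ] ℝ :=
  (η x).compContinuousLinearMap
    ((trivializationAt R6 (TangentSpace (𝓡 6) : M → Type _) x₀).symmL ℝ x)

/-- The expression of an endomorphism in the trivialisation of the tangent bundle at `x₀`. -/
def endInCoord (A : ∀ x : M, TangentSpace (𝓡 6) x →L[ℝ] TangentSpace (𝓡 6) x) (x₀ x : M) :
    R6 →L[ℝ] R6 :=
  ContinuousLinearMap.inCoordinates R6 (TangentSpace (𝓡 6) : M → Type _) R6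
    (TangentSpace (𝓡 6) : M → Type _) x₀ x x₀ x (A x)

theorem smoothEndOn_iff {A : ∀ x : M, TangentSpace (𝓡 6) x →L[ℝ] TangentSpace (𝓡 6) x}
    {U : Set M} :
    SmoothEndOn A U ↔ ∀ x₀ ∈ U,
      ContMDiffWithinAt (𝓡 6) 𝓘(ℝ, R6 →L[ℝ] R6) ∞ (endInCoord A x₀) U x₀ := by
  refine forall₂_congr fun x₀ _ => ?_
  rw [contMDiffWithinAt_hom_bundle]
  exact and_iff_right contMDiffWithinAt_id

theorem smoothFormOn_top_iff {η : ∀ x : M, TangentSpace (𝓡 6) x [⋀^Fin 6]→L[ℝ] ℝ} {U : Set M} :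
    SmoothFormOn η U ↔ ∀ x₀ ∈ U,
      ContMDiffWithinAt (𝓡 6) 𝓘(ℝ, ℝ) ∞ (fun x => formInCoord η x₀ x stdBasis) U x₀ := by
  refine forall₂_congr fun x₀ _ => ?_
  change ContMDiffWithinAt _ _ _ (formInCoord η x₀) _ _ ↔ _
  constructor
  · intro h
    exact (ContinuousAlternatingMap.apply ℝ R6 ℝ
      stdBasis).contMDiff.contMDiffAt.comp_contMDiffWithinAt _ h
  · intro h
    have : formInCoord η x₀ = fun x => formInCoord η x₀ x stdBasis • stdBasis.detL := by
      ext1 x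
      exact (formInCoord η x₀ x).eq_smul_detL stdBasis
    rw [this]
    exact h.smul contMDiffWithinAt_const

instance (x : M) : T2Space (TangentSpace (𝓡 6) x) := inferInstanceAs (T2Space R6)

/-- The coordinate frame at `x` of the trivialisation at `x₀`. -/
def coordFrame (x₀ x : M)
    (hx : x ∈ (trivializationAt R6 (TangentSpace (𝓡 6) : M → Type _) x₀).baseSet) :
    TangentSpace (𝓡 6) x ≃L[ℝ] R6 :=
  (trivializationAt R6 (TangentSpace (𝓡 6) : M → Type _) x₀).continuousLinearEquivAt ℝ x hx

theorem coordFrame_symm_apply (x₀ x : M)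
    (hx : x ∈ (trivializationAt R6 (TangentSpace (𝓡 6) : M → Type _) x₀).baseSet) (v : R6) :
    (coordFrame x₀ x hx).symm v =
      (trivializationAt R6 (TangentSpace (𝓡 6) : M → Type _) x₀).symmL ℝ x v := by
  rw [coordFrame, Bundle.Trivialization.symm_continuousLinearEquivAt_eq]

theorem formInCoord_apply {k : ℕ} (η : ∀ x : M, TangentSpace (𝓡 6) x [⋀^Fin k]→L[ℝ] ℝ) (x₀ x : M)
    (hx : x ∈ (trivializationAt R6 (TangentSpace (𝓡 6) : M → Type _) x₀).baseSet)
    (v : Fin k → R6) :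
    formInCoord η x₀ x v = η x ((coordFrame x₀ x hx).symm ∘ v) := by
  refine congrArg (η x) (funext fun i => ?_)
  exact (coordFrame_symm_apply x₀ x hx (v i)).symm

theorem toAlternatingMap_formInCoord {k : ℕ}
    (η : ∀ x : M, TangentSpace (𝓡 6) x [⋀^Fin k]→L[ℝ] ℝ) (x₀ x : M)
    (hx : x ∈ (trivializationAt R6 (TangentSpace (𝓡 6) : M → Type _) x₀).baseSet) :
    (formInCoord η x₀ x).toAlternatingMap = (η x).toAlternatingMap.compLinearMap
      ((coordFrame x₀ x hx).symm.toLinearEquiv : R6 →ₗ[ℝ] TangentSpace (𝓡 6) x) := by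
  ext v
  exact formInCoord_apply η x₀ x hx v

/-- The coordinate basis at `x` of the trivialisation at `x₀`. -/
def coordBasis (x₀ x : M)
    (hx : x ∈ (trivializationAt R6 (TangentSpace (𝓡 6) : M → Type _) x₀).baseSet) :
    Basis (Fin 6) ℝ (TangentSpace (𝓡 6) x) :=
  stdBasis.map (coordFrame x₀ x hx).symm.toLinearEquiv

theorem endInCoord_eq (A : ∀ x : M, TangentSpace (𝓡 6) x →L[ℝ] TangentSpace (𝓡 6) x) (x₀ x : M)
    (hx : x ∈ (trivializationAt R6 (TangentSpace (𝓡 6) : M → Type _) x₀).baseSet) (v : R6) :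
    endInCoord A x₀ x v = coordFrame x₀ x hx (A x ((coordFrame x₀ x hx).symm v)) := by
  rw [endInCoord, ContinuousLinearMap.inCoordinates_eq hx hx]
  rfl

variable {Ω : ∀ x : M, TangentSpace (𝓡 6) x [⋀^Fin 3]→L[ℝ] ℝ}

theorem topForm_inCoord (A : ∀ x : M, TangentSpace (𝓡 6) x →L[ℝ] TangentSpace (𝓡 6) x) (x₀ x : M)
    (hx : x ∈ (trivializationAt R6 (TangentSpace (𝓡 6) : M → Type _) x₀).baseSet)
    (v : Fin 6 → R6) :
    topForm (formInCoord Ω x₀ x).toAlternatingMap (endInCoord A x₀ x : R6 →ₗ[ℝ] R6) v =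
      topForm (Ω x).toAlternatingMap (A x : TangentSpace (𝓡 6) x →ₗ[ℝ] TangentSpace (𝓡 6) x)
        ((coordFrame x₀ x hx).symm ∘ v) := by
  rw [toAlternatingMap_formInCoord Ω x₀ x hx]
  refine topForm_compLinearMap (Ω x).toAlternatingMap
    ((coordFrame x₀ x hx).symm.toLinearEquiv : R6 →ₗ[ℝ] TangentSpace (𝓡 6) x) _ _ (fun w => ?_) v
  have := endInCoord_eq A x₀ x hx w
  change (coordFrame x₀ x hx).symm (endInCoord A x₀ x w) = A x ((coordFrame x₀ x hx).symm w)
  rw [this, ContinuousLinearEquiv.symm_apply_apply]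

theorem hitchinMapL_inCoord (x₀ x : M)
    (hx : x ∈ (trivializationAt R6 (TangentSpace (𝓡 6) : M → Type _) x₀).baseSet) (v : R6) :
    (coordFrame x₀ x hx).symm (hitchinMapL (formInCoord Ω x₀ x) stdBasis v) =
      hitchinMapL (Ω x) (coordBasis x₀ x hx) ((coordFrame x₀ x hx).symm v) := by
  rw [hitchinMapL_apply, hitchinMapL_apply, toAlternatingMap_formInCoord Ω x₀ x hx]
  exact hitchinMap_compLinearMap (Ω x).toAlternatingMap
    (coordFrame x₀ x hx).symm.toLinearEquiv stdBasis v

end Manifold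

/-! ### Smooth sections of the pure line correspond to smooth 6-forms. -/

section PureLine

variable {M : Type*} [TopologicalSpace M] [ChartedSpace R6 M] [IsManifold (𝓡 6) ∞ M]
  {Ω : ∀ x : M, TangentSpace (𝓡 6) x [⋀^Fin 3]→L[ℝ] ℝ}

theorem IsTypeTwoForm.isTypeTwo (hΩ : IsTypeTwoForm Ω) (x : M) :
    IsTypeTwo (Ω x).toAlternatingMap :=
  isTypeTwo_of_deltaSet (hΩ.2 x)

theorem eventually_mem_baseSet (x₀ : M) : ∀ᶠ x in 𝓝 x₀,
    x ∈ (trivializationAt R6 (TangentSpace (𝓡 6) : M → Type _) x₀).baseSet :=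
  (trivializationAt R6 (TangentSpace (𝓡 6) : M → Type _) x₀).open_baseSet.mem_nhds
    (FiberBundle.mem_baseSet_trivializationAt' x₀)

theorem hitchinScalar_inCoord (x₀ x : M)
    (hx : x ∈ (trivializationAt R6 (TangentSpace (𝓡 6) : M → Type _) x₀).baseSet) :
    hitchinScalar (formInCoord Ω x₀ x).toAlternatingMap stdBasis =
      hitchinScalar (Ω x).toAlternatingMap (coordBasis x₀ x hx) := by
  have h1 : (coordFrame x₀ x hx).symm (hitchinMapL (formInCoord Ω x₀ x) stdBasis
      (hitchinMapL (formInCoord Ω x₀ x) stdBasis (stdBasis 0))) =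
      hitchinMapL (Ω x) (coordBasis x₀ x hx) (hitchinMapL (Ω x) (coordBasis x₀ x hx)
        ((coordFrame x₀ x hx).symm (stdBasis 0))) := by
    rw [hitchinMapL_inCoord, hitchinMapL_inCoord]
  simp only [hitchinMapL_apply, hitchinMap_hitchinMap, map_smul] at h1
  refine smul_left_injective ℝ ?_ h1
  rw [Ne, map_eq_zero_iff _ (coordFrame x₀ x hx).symm.injective]
  exact stdBasis.ne_zero 0

theorem endInCoord_eq_smul {A : ∀ x : M, TangentSpace (𝓡 6) x →L[ℝ] TangentSpace (𝓡 6) x}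
    {x₀ x : M} (hx : x ∈ (trivializationAt R6 (TangentSpace (𝓡 6) : M → Type _) x₀).baseSet)
    {a : ℝ} (h : A x = a • hitchinMapL (Ω x) (coordBasis x₀ x hx)) :
    endInCoord A x₀ x = a • hitchinMapL (formInCoord Ω x₀ x) stdBasis := by
  ext1 v
  rw [endInCoord_eq A x₀ x hx, h, smul_apply, smul_apply,
    ← hitchinMapL_inCoord, map_smul, ContinuousLinearEquiv.apply_symm_apply]

theorem topForm_inCoord_stdBasis
    (A : ∀ x : M, TangentSpace (𝓡 6) x →L[ℝ] TangentSpace (𝓡 6) x) (x₀ x : M)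
    (hx : x ∈ (trivializationAt R6 (TangentSpace (𝓡 6) : M → Type _) x₀).baseSet) :
    topForm (formInCoord Ω x₀ x).toAlternatingMap (endInCoord A x₀ x : R6 →ₗ[ℝ] R6) stdBasis =
      topForm (Ω x).toAlternatingMap (A x : TangentSpace (𝓡 6) x →ₗ[ℝ] TangentSpace (𝓡 6) x)
        (coordBasis x₀ x hx) := by
  rw [topForm_inCoord A x₀ x hx]
  congr 1

theorem hitchinScalar_inCoord_neg (hΩ : IsTypeTwoForm Ω) (x₀ x : M)
    (hx : x ∈ (trivializationAt R6 (TangentSpace (𝓡 6) : M → Type _) x₀).baseSet) :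
    hitchinScalar (formInCoord Ω x₀ x).toAlternatingMap stdBasis < 0 := by
  rw [hitchinScalar_inCoord x₀ x hx]
  exact (hΩ.isTypeTwo x).hitchinScalar_neg _

/-- A section of the line is `A = aK` with `a = topForm Ω A / (6λ)`. Both `K` and `λ` vary smoothly
and `λ ≠ 0`, so smoothness of `A` reduces to that of one scalar. -/
theorem contMDiffWithinAt_endInCoord_iff (hΩ : IsTypeTwoForm Ω)
    {A : ∀ x : M, TangentSpace (𝓡 6) x →L[ℝ] TangentSpace (𝓡 6) x}
    (hA : ∀ x, A x ∈ pureSpan Ω x) (U : Set M) (x₀ : M) :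
    ContMDiffWithinAt (𝓡 6) 𝓘(ℝ, R6 →L[ℝ] R6) ∞ (endInCoord A x₀) U x₀ ↔
      ContMDiffWithinAt (𝓡 6) 𝓘(ℝ, ℝ) ∞ (fun x => topForm (formInCoord Ω x₀ x).toAlternatingMap
        (endInCoord A x₀ x : R6 →ₗ[ℝ] R6) stdBasis) U x₀ := by
  have hΩ₀ : ContMDiffWithinAt (𝓡 6) 𝓘(ℝ, R6 [⋀^Fin 3]→L[ℝ] ℝ) ∞ (formInCoord Ω x₀) U x₀ :=
    (hΩ.1 x₀ (Set.mem_univ _)).mono (Set.subset_univ U)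
  constructor
  · intro h
    exact ContMDiffAt.comp_contMDiffWithinAt
      (g := fun p : (R6 [⋀^Fin 3]→L[ℝ] ℝ) × (R6 →L[ℝ] R6) =>
        topForm p.1.toAlternatingMap (p.2 : R6 →ₗ[ℝ] R6) stdBasis)
      (f := fun x => (formInCoord Ω x₀ x, endInCoord A x₀ x)) x₀
      contDiff_topForm.contMDiff.contMDiffAt (hΩ₀.prodMk_space h)
  · intro h
    have hl : ContMDiffWithinAt (𝓡 6) 𝓘(ℝ, ℝ) ∞ (fun x =>
        6 * hitchinScalar (formInCoord Ω x₀ x).toAlternatingMap stdBasis) U x₀ :=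
      contMDiffWithinAt_const.mul
        (contDiff_hitchinScalar.contMDiff.contMDiffAt.comp_contMDiffWithinAt x₀ hΩ₀)
    have hK : ContMDiffWithinAt (𝓡 6) 𝓘(ℝ, R6 →L[ℝ] R6) ∞ (fun x =>
        hitchinMapL (formInCoord Ω x₀ x) stdBasis) U x₀ :=
      contDiff_hitchinMapL.contMDiff.contMDiffAt.comp_contMDiffWithinAt x₀ hΩ₀
    have hmem := FiberBundle.mem_baseSet_trivializationAt' (F := R6)
      (E := (TangentSpace (𝓡 6) : M → Type _)) x₀
    have hne : 6 * hitchinScalar (formInCoord Ω x₀ x₀).toAlternatingMap stdBasis ≠ 0 :=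
      mul_ne_zero (by norm_num) (hitchinScalar_inCoord_neg hΩ x₀ x₀ hmem).ne
    have key (x : M)
        (hx : x ∈ (trivializationAt R6 (TangentSpace (𝓡 6) : M → Type _) x₀).baseSet) :
        endInCoord A x₀ x = (topForm (formInCoord Ω x₀ x).toAlternatingMap
          (endInCoord A x₀ x : R6 →ₗ[ℝ] R6) stdBasis /
          (6 * hitchinScalar (formInCoord Ω x₀ x).toAlternatingMap stdBasis)) •
          hitchinMapL (formInCoord Ω x₀ x) stdBasis := by
      refine endInCoord_eq_smul hx ?_
      rw [topForm_inCoord_stdBasis A x₀ x hx, hitchinScalar_inCoord x₀ x hx]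
      refine eq_smul_hitchinMapL _ (hΩ.isTypeTwo x) ?_
      rw [← span_pure_eq _ (hΩ.isTypeTwo x)]
      exact hA x
    refine ((h.div₀ hl hne).smul hK).congr_of_eventuallyEq ?_ (key x₀ hmem)
    filter_upwards [nhdsWithin_le_nhds (eventually_mem_baseSet x₀)] with x hx using key x hx

/-- The isomorphism is `A ↦ topForm Ω A`, in which the auxiliary basis drops out; its values can
therefore be read in any trivialisation. -/
theorem isIsomorphicToTopForms_pureSpan (hΩ : IsTypeTwoForm Ω) :
    IsIsomorphicToTopForms (pureSpan Ω) := by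
  refine ⟨fun x => spanPureEquiv (coordBasis x x (FiberBundle.mem_baseSet_trivializationAt' x))
    (hΩ.isTypeTwo x), fun U _ A => ?_⟩
  rw [smoothEndOn_iff, smoothFormOn_top_iff]
  refine forall₂_congr fun x₀ _ => ?_
  rw [contMDiffWithinAt_endInCoord_iff hΩ (fun x => (A x).2)]
  have key (x : M)
      (hx : x ∈ (trivializationAt R6 (TangentSpace (𝓡 6) : M → Type _) x₀).baseSet) :
      topForm (formInCoord Ω x₀ x).toAlternatingMap
        (endInCoord (fun x => (A x : TangentSpace (𝓡 6) x →L[ℝ] TangentSpace (𝓡 6) x)) x₀ x :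
          R6 →ₗ[ℝ] R6) stdBasis =
      formInCoord (fun x => spanPureEquiv
        (coordBasis x x (FiberBundle.mem_baseSet_trivializationAt' x))
          (hΩ.isTypeTwo x) (A x)) x₀ x stdBasis := by
    rw [topForm_inCoord _ x₀ x hx, formInCoord_apply _ x₀ x hx]
    exact (spanPureEquiv_apply _ _ _ _).symm
  have h0 := key x₀ (FiberBundle.mem_baseSet_trivializationAt' x₀)
  have h1 := (eventually_mem_baseSet x₀).mono key
  exact Filter.EventuallyEq.contMDiffWithinAt_iff (nhdsWithin_le_nhds h1) h0

end PureLine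

/-! ### Local frames of the pure line. -/

section LineSubbundle

variable {M : Type*} [TopologicalSpace M] [ChartedSpace R6 M] [IsManifold (𝓡 6) ∞ M]
  {Ω : ∀ x : M, TangentSpace (𝓡 6) x [⋀^Fin 3]→L[ℝ] ℝ}

open Classical in
/-- The `6`-form `dx₁ ∧ ⋯ ∧ dx₆` of the trivialisation at `x₀`. -/
def coordVolume (x₀ x : M) : TangentSpace (𝓡 6) x [⋀^Fin 6]→L[ℝ] ℝ :=
  if hx : x ∈ (trivializationAt R6 (TangentSpace (𝓡 6) : M → Type _) x₀).baseSet then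
    (coordBasis x₀ x hx).detL else 0

theorem coordVolume_ne_zero (x₀ x : M)
    (hx : x ∈ (trivializationAt R6 (TangentSpace (𝓡 6) : M → Type _) x₀).baseSet) :
    coordVolume x₀ x ≠ 0 := by
  intro h
  have h1 : (coordBasis x₀ x hx).detL (coordBasis x₀ x hx) = 1 := (coordBasis x₀ x hx).det_self
  rw [coordVolume, dif_pos hx] at h
  rw [h] at h1
  exact zero_ne_one h1

theorem formInCoord_coordVolume (x₀ x₁ x : M)
    (h₀ : x ∈ (trivializationAt R6 (TangentSpace (𝓡 6) : M → Type _) x₀).baseSet)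
    (h₁ : x ∈ (trivializationAt R6 (TangentSpace (𝓡 6) : M → Type _) x₁).baseSet) :
    formInCoord (coordVolume x₀) x₁ x stdBasis = stdBasis.detL fun i =>
      ((trivializationAt R6 (TangentSpace (𝓡 6) : M → Type _) x₁).coordChangeL ℝ
        (trivializationAt R6 (TangentSpace (𝓡 6) : M → Type _) x₀) x : R6 →L[ℝ] R6)
        (stdBasis i) := by
  rw [formInCoord_apply _ x₁ x h₁, coordVolume, dif_pos h₀, Module.Basis.detL_apply, coordBasis,
    Module.Basis.det_map, Module.Basis.detL_apply]
  congr 1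
  ext1 i
  rw [ContinuousLinearEquiv.coe_coe, Bundle.Trivialization.coe_coordChangeL _ _ ⟨h₁, h₀⟩]
  rfl

theorem smoothFormOn_coordVolume (x₀ : M) : SmoothFormOn (coordVolume x₀)
    (trivializationAt R6 (TangentSpace (𝓡 6) : M → Type _) x₀).baseSet := by
  rw [smoothFormOn_top_iff]
  intro x₁ hx₁
  have hmem := FiberBundle.mem_baseSet_trivializationAt' (F := R6)
      (E := (TangentSpace (𝓡 6) : M → Type _)) x₁
  have h1 := (contMDiffAt_coordChangeL (IB := 𝓡 6) (n := ∞) hmem hx₁).contMDiffWithinAt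
    (s := (trivializationAt R6 (TangentSpace (𝓡 6) : M → Type _) x₀).baseSet)
  have h2 : ContDiff ℝ ∞ fun g : R6 →L[ℝ] R6 => stdBasis.detL fun i => g (stdBasis i) :=
    (ContinuousMultilinearMap.contDiff
      (stdBasis.detL.toContinuousMultilinearMap)).comp
      (contDiff_pi.2 fun i => contDiff_id.clm_apply contDiff_const)
  refine (h2.contMDiff.contMDiffAt.comp_contMDiffWithinAt x₁ h1).congr_of_eventuallyEq ?_
    (formInCoord_coordVolume x₀ x₁ x₁ hx₁ hmem)
  filter_upwards [nhdsWithin_le_nhds (eventually_mem_baseSet x₁), self_mem_nhdsWithin]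
    with x hx hx' using formInCoord_coordVolume x₀ x₁ x hx' hx

/-- The local frame is the preimage of a coordinate volume form under the isomorphism with 6-forms.
-/
theorem isSmoothLineSubbundle_pureSpan (hΩ : IsTypeTwoForm Ω) :
    IsSmoothLineSubbundle (pureSpan Ω) := by
  intro x₀
  obtain ⟨h, hh⟩ := isIsomorphicToTopForms_pureSpan hΩ
  refine ⟨_, (trivializationAt R6 (TangentSpace (𝓡 6) : M → Type _) x₀).open_baseSet,
    FiberBundle.mem_baseSet_trivializationAt' x₀, fun x => ((h x).symm (coordVolume x₀ x)).1,
    (hh _ (trivializationAt R6 (TangentSpace (𝓡 6) : M → Type _) x₀).open_baseSet _).2 ?_,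
    fun x hx => ?_⟩
  · simpa using smoothFormOn_coordVolume x₀
  · have hne : ((h x).symm (coordVolume x₀ x)).1 ≠ 0 := by
      simpa using coordVolume_ne_zero x₀ x hx
    refine ⟨hne, ?_⟩
    have hmem := ((h x).symm (coordVolume x₀ x)).2
    change pureSpan Ω x = Submodule.span ℝ {((h x).symm (coordVolume x₀ x)).1}
    generalize ((h x).symm (coordVolume x₀ x)).1 = A at hne hmem ⊢
    rw [pureSpan, span_pure_eq (coordBasis x₀ x hx) (hΩ.isTypeTwo x)] at hmem ⊢
    obtain ⟨a, rfl⟩ := Submodule.mem_span_singleton.1 hmem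
    have ha : a ≠ 0 := fun ha => hne (by rw [ha, zero_smul])
    exact (Submodule.span_singleton_smul_eq (R := ℝ) ha.isUnit
      (hitchinMapL (Ω x) (coordBasis x₀ x hx))).symm

end LineSubbundle

/-! ### Orientations as sign functions relative to the preferred charts. -/

section Orientation

/-- The Jacobian determinant at `x` of the coordinate change from `e` to `e'`. -/
def jacobianDet {M : Type*} [TopologicalSpace M] (e e' : OpenPartialHomeomorph M R6) (x : M) : ℝ :=
  (fderiv ℝ (fun y : R6 => e' (e.symm y)) (e x)).det

theorem jacobianDet_self {M : Type*} [TopologicalSpace M] {e : OpenPartialHomeomorph M R6} {x : M}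
    (hx : x ∈ e.source) : jacobianDet e e x = 1 := by
  have h1 : (fun y : R6 => e (e.symm y)) =ᶠ[𝓝 (e x)] id := by
    filter_upwards [e.open_target.mem_nhds (e.map_source hx)] with y hy using e.right_inv hy
  rw [jacobianDet, h1.fderiv_eq, fderiv_id]
  exact LinearMap.det_id

variable {M : Type*} [TopologicalSpace M] [ChartedSpace R6 M]

variable {e e' e'' : OpenPartialHomeomorph M R6} {x : M}

theorem contDiffAt_transition (he : e ∈ IsManifold.maximalAtlas (𝓡 6) ∞ M)
    (he' : e' ∈ IsManifold.maximalAtlas (𝓡 6) ∞ M) (hx : x ∈ e.source) (hx' : x ∈ e'.source) :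
    ContDiffAt ℝ ∞ (fun y : R6 => e' (e.symm y)) (e x) := by
  rw [← contMDiffAt_iff_contDiffAt]
  refine ContMDiffAt.comp (e x) (I' := 𝓡 6) (g := e') ?_
    (contMDiffAt_symm_of_mem_maximalAtlas he (e.map_source hx))
  rw [e.left_inv hx]
  exact contMDiffAt_of_mem_maximalAtlas he' hx'

theorem differentiableAt_transition (he : e ∈ IsManifold.maximalAtlas (𝓡 6) ∞ M)
    (he' : e' ∈ IsManifold.maximalAtlas (𝓡 6) ∞ M) (hx : x ∈ e.source) (hx' : x ∈ e'.source) :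
    DifferentiableAt ℝ (fun y : R6 => e' (e.symm y)) (e x) :=
  (contDiffAt_transition he he' hx hx').differentiableAt (by simp)

theorem jacobianDet_comp (he : e ∈ IsManifold.maximalAtlas (𝓡 6) ∞ M)
    (he' : e' ∈ IsManifold.maximalAtlas (𝓡 6) ∞ M) (he'' : e'' ∈ IsManifold.maximalAtlas (𝓡 6) ∞ M)
    (hx : x ∈ e.source) (hx' : x ∈ e'.source) (hx'' : x ∈ e''.source) :
    jacobianDet e e'' x = jacobianDet e' e'' x * jacobianDet e e' x := by
  have h1 : (fun y : R6 => e'' (e.symm y)) =ᶠ[𝓝 (e x)]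
      (fun y : R6 => e'' (e'.symm y)) ∘ fun y : R6 => e' (e.symm y) := by
    have hc : Filter.Tendsto e.symm (𝓝 (e x)) (𝓝 x) := e.tendsto_symm hx
    filter_upwards [hc (e'.open_source.mem_nhds hx')] with y hy
    simp only [Function.comp_apply]
    rw [e'.left_inv hy]
  have h2 : e' (e.symm (e x)) = e' x := by rw [e.left_inv hx]
  have h3 := fderiv_comp (𝕜 := ℝ) (e x) (g := fun y : R6 => e'' (e'.symm y))
    (f := fun y : R6 => e' (e.symm y))
    (by rw [h2]; exact differentiableAt_transition he' he'' hx' hx'')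
    (differentiableAt_transition he he' hx hx')
  rw [jacobianDet, h1.fderiv_eq, h3, h2]
  exact LinearMap.det_comp _ _

theorem jacobianDet_mul_symm (he : e ∈ IsManifold.maximalAtlas (𝓡 6) ∞ M)
    (he' : e' ∈ IsManifold.maximalAtlas (𝓡 6) ∞ M) (hx : x ∈ e.source) (hx' : x ∈ e'.source) :
    jacobianDet e' e x * jacobianDet e e' x = 1 := by
  rw [← jacobianDet_comp he he' he hx hx' hx, jacobianDet_self hx]

theorem continuousAt_jacobianDet (he : e ∈ IsManifold.maximalAtlas (𝓡 6) ∞ M)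
    (he' : e' ∈ IsManifold.maximalAtlas (𝓡 6) ∞ M) (hx : x ∈ e.source) (hx' : x ∈ e'.source) :
    ContinuousAt (jacobianDet e e') x := by
  have h1 := ((contDiffAt_transition he he' hx hx').fderiv_right (m := 0) (by simp)).continuousAt
  exact ContinuousLinearMap.continuous_det.continuousAt.comp
    (ContinuousAt.comp (g := fderiv ℝ fun y : R6 => e' (e.symm y)) h1 (e.continuousAt hx))

/-- A nowhere vanishing function `s` whose product with the volume form of the tangent spaces
(identified with the model space) has locally constant sign in the preferred charts. -/
def IsOrientingFunction (s : M → ℝ) : Prop :=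
  (∀ x, s x ≠ 0) ∧
    ∀ x₀, ∀ᶠ x in 𝓝 x₀, 0 < s x₀ * (s x * jacobianDet (chartAt R6 x₀) (chartAt R6 x) x)

variable [IsManifold (𝓡 6) ∞ M]

/-- `s x` is the Jacobian at `x` from an oriented chart `e x` to the preferred one. By the chain
rule the product in question is `s(x)²`, times a positive transition between oriented charts, times
a factor that is continuous and equals 1 at `x₀`. -/
theorem exists_isOrientingFunction (h : IsOrientable M) :
    ∃ s : M → ℝ, IsOrientingFunction s := by
  obtain ⟨A, hA, hcov, hpos⟩ := h
  choose e heA hxe using hcov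
  have hc (x : M) := IsManifold.chart_mem_maximalAtlas (I := 𝓡 6) (n := ∞) x
  have hne (x : M) : jacobianDet (e x) (chartAt R6 x) x ≠ 0 := fun h0 => by
    have := jacobianDet_mul_symm (hA (heA x)) (hc x) (hxe x) (mem_chart_source R6 x)
    rw [h0, mul_zero] at this
    exact zero_ne_one this
  refine ⟨fun x => jacobianDet (e x) (chartAt R6 x) x, hne, fun x₀ => ?_⟩
  have h0 := jacobianDet_mul_symm (hc x₀) (hA (heA x₀)) (mem_chart_source R6 x₀) (hxe x₀)
  have hcont : ContinuousAt (fun x => jacobianDet (e x₀) (chartAt R6 x₀) x₀ *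
      jacobianDet (chartAt R6 x₀) (e x₀) x) x₀ :=
    continuousAt_const.mul (continuousAt_jacobianDet (hc x₀) (hA (heA x₀))
      (mem_chart_source R6 x₀) (hxe x₀))
  filter_upwards [hcont.eventually (lt_mem_nhds (h0.symm ▸ zero_lt_one)),
    (e x₀).open_source.mem_nhds (hxe x₀),
    (chartAt R6 x₀).open_source.mem_nhds (mem_chart_source R6 x₀)] with x h1 h2 h3
  rw [jacobianDet_comp (hc x₀) (hA (heA x)) (hc x) h3 (hxe x) (mem_chart_source R6 x),
    jacobianDet_comp (hc x₀) (hA (heA x₀)) (hA (heA x)) h3 h2 (hxe x)]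
  have h4 : 0 < jacobianDet (e x₀) (e x) x := hpos _ (heA x₀) _ (heA x) x ⟨h2, hxe x⟩
  have h5 := mul_pos (mul_pos h1 h4) (pow_pos (abs_pos.2 (hne x)) 2)
  rw [sq_abs] at h5
  refine h5.trans_eq ?_
  ring

theorem exists_linearEquiv_det_neg : ∃ R : R6 ≃L[ℝ] R6, (R : R6 →L[ℝ] R6).det < 0 := by
  have hv : (stdBasis 0 : R6) ≠ 0 := stdBasis.ne_zero 0
  refine ⟨((ℝ ∙ (stdBasis 0 : R6))ᗮ.reflection).toContinuousLinearEquiv, ?_⟩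
  have h1 := Submodule.det_reflection (ℝ ∙ (stdBasis 0 : R6))ᗮ
  rw [Submodule.orthogonal_orthogonal, finrank_span_singleton hv, pow_one] at h1
  refine lt_of_eq_of_lt h1 (by norm_num)

theorem transHomeomorph_mem_maximalAtlas (he : e ∈ IsManifold.maximalAtlas (𝓡 6) ∞ M)
    (R : R6 ≃L[ℝ] R6) :
    e.transHomeomorph R.toHomeomorph ∈ IsManifold.maximalAtlas (𝓡 6) ∞ M := by
  refine OpenPartialHomeomorph.mem_maximalAtlas_of_contMDiffOn _ ?_ ?_
  · exact R.contDiff.contMDiff.comp_contMDiffOn (contMDiffOn_of_mem_maximalAtlas he)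
  · exact (contMDiffOn_symm_of_mem_maximalAtlas he).comp R.symm.contDiff.contMDiff.contMDiffOn
      fun y hy => hy

theorem jacobianDet_transHomeomorph (he : e ∈ IsManifold.maximalAtlas (𝓡 6) ∞ M)
    (he' : e' ∈ IsManifold.maximalAtlas (𝓡 6) ∞ M) (hx : x ∈ e.source) (hx' : x ∈ e'.source)
    (R : R6 ≃L[ℝ] R6) :
    (R : R6 →L[ℝ] R6).det * jacobianDet (e.transHomeomorph R.toHomeomorph) e' x =
      jacobianDet e e' x := by
  have heR := transHomeomorph_mem_maximalAtlas he R
  rw [jacobianDet_comp he heR he' hx hx hx', mul_comm]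
  congr 1
  have h1 : (fun y : R6 => e.transHomeomorph R.toHomeomorph (e.symm y)) =ᶠ[𝓝 (e x)] R := by
    filter_upwards [e.open_target.mem_nhds (e.map_source hx)] with y hy
    exact congrArg R (e.right_inv hy)
  rw [jacobianDet, h1.fderiv_eq, R.fderiv]

theorem IsOrientingFunction.isOrientable {s : M → ℝ} (hs : IsOrientingFunction s) :
    IsOrientable M := by
  have hc (x : M) := IsManifold.chart_mem_maximalAtlas (I := 𝓡 6) (n := ∞) x
  -- The oriented atlas consists of all charts whose Jacobian to the preferred chart has the sign of
  -- `s` at every point; two of them differ by a positive factor.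
  refine ⟨{e | e ∈ IsManifold.maximalAtlas (𝓡 6) ∞ M ∧
    ∀ x ∈ e.source, 0 < s x * jacobianDet e (chartAt R6 x) x}, fun e he => he.1, fun x₀ => ?_, ?_⟩
  · obtain ⟨U, hU, hUo, hxU⟩ := eventually_nhds_iff.1 (hs.2 x₀)
    have he : (chartAt R6 x₀).restr U ∈ IsManifold.maximalAtlas (𝓡 6) ∞ M :=
      restr_mem_maximalAtlas _ (hc x₀) hUo
    have hmem (x : M) : x ∈ ((chartAt R6 x₀).restr U).source ↔
        x ∈ (chartAt R6 x₀).source ∧ x ∈ U := by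
      rw [OpenPartialHomeomorph.restr_source, hUo.interior_eq, Set.mem_inter_iff]
    rcases lt_or_gt_of_ne (hs.1 x₀) with h0 | h0
    -- Where `s x₀ < 0` the preferred chart has the wrong sign, and a reflection corrects it.
    · obtain ⟨R, hR⟩ := exists_linearEquiv_det_neg
      refine ⟨_, ⟨transHomeomorph_mem_maximalAtlas he R, fun x hx => ?_⟩,
        (hmem x₀).2 ⟨mem_chart_source R6 x₀, hxU⟩⟩
      have h1 := hU x ((hmem x).1 hx).2
      have h2 := jacobianDet_transHomeomorph he (hc x) hx (mem_chart_source R6 x) R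
      change _ = jacobianDet (chartAt R6 x₀) (chartAt R6 x) x at h2
      rw [← h2] at h1
      exact (mul_pos_iff_of_pos_left (mul_pos_of_neg_of_neg h0 hR)).1
        (h1.trans_eq (by ring))
    · exact ⟨_, ⟨he, fun x hx => pos_of_mul_pos_right (hU x ((hmem x).1 hx).2) h0.le⟩,
        (hmem x₀).2 ⟨mem_chart_source R6 x₀, hxU⟩⟩
  · rintro e ⟨he, hpos⟩ e' ⟨he', hpos'⟩ x ⟨hx, hx'⟩
    change 0 < jacobianDet e e' x
    have h1 := hpos x hx
    have h2 := hpos' x hx'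
    rw [jacobianDet_comp he he' (hc x) hx hx' (mem_chart_source R6 x), ← mul_assoc] at h1
    exact pos_of_mul_pos_right h1 h2.le

end Orientation

/-! ### Choosing between the two pure complex structures by sign. -/

section SignNormalisation

variable {V : Type*} [AddCommGroup V] [Module ℝ V] [TopologicalSpace V]
  [IsTopologicalAddGroup V] [ContinuousSMul ℝ V] [T2Space V] (b : Basis (Fin 6) ℝ V)
  {Ω : V [⋀^Fin 3]→L[ℝ] ℝ}

theorem topForm_smul_hitchinMapL (c : ℝ) :
    topForm Ω.toAlternatingMap ((c • hitchinMapL Ω b : V →L[ℝ] V) : V →ₗ[ℝ] V) b =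
      c * (6 * hitchinScalar Ω.toAlternatingMap b) := by
  rw [ContinuousLinearMap.toLinearMap_smul, map_smul, AlternatingMap.smul_apply, coe_hitchinMapL,
    topForm_hitchinMap_self, smul_eq_mul]

/-- A pure complex structure is determined by the sign of the `6`-form it defines. -/
theorem pure_eq_of_sign (hΩ : IsTypeTwo Ω.toAlternatingMap) {J : V →L[ℝ] V}
    (hJ : IsComplexStr J ∧ IsPureWrt Ω J) {σ : ℝ}
    (hσ : 0 < σ * topForm Ω.toAlternatingMap (J : V →ₗ[ℝ] V) b) :
    J = (-(σ / |σ|) * (√(-hitchinScalar Ω.toAlternatingMap b))⁻¹) • hitchinMapL Ω b := by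
  obtain ⟨c, rfl, hc⟩ := (isComplexStr_and_isPureWrt_iff b hΩ).1 hJ
  have hl := hΩ.hitchinScalar_neg b
  rw [topForm_smul_hitchinMapL] at hσ
  have h1 : (√(-hitchinScalar Ω.toAlternatingMap b))⁻¹ = |c| := by
    rw [← Real.sqrt_inv, ← Real.sqrt_sq_eq_abs]
    congr 1
    rw [inv_eq_iff_eq_inv, ← one_div, eq_div_iff (pow_ne_zero 2 ?_)]
    · linarith
    · rintro rfl
      norm_num at hc
  rw [h1]
  congr 1
  rcases lt_trichotomy σ 0 with h | h | h
  · have hcpos : 0 < c := by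
      by_contra! h2
      nlinarith [mul_nonneg_of_nonpos_of_nonpos h.le h2]
    rw [abs_of_neg h, abs_of_pos hcpos, div_neg, div_self h.ne]
    ring
  · simp [h] at hσ
  · have hcneg : c < 0 := by
      by_contra! h2
      nlinarith [mul_nonneg h.le h2]
    rw [abs_of_pos h, abs_of_neg hcneg, div_self h.ne']
    ring

theorem exists_pure_of_sign (hΩ : IsTypeTwo Ω.toAlternatingMap) {σ : ℝ} (hσ : σ ≠ 0) :
    ∃ J : V →L[ℝ] V, (IsComplexStr J ∧ IsPureWrt Ω J) ∧
      0 < σ * topForm Ω.toAlternatingMap (J : V →ₗ[ℝ] V) b := by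
  have hl := hΩ.hitchinScalar_neg b
  have hc := hΩ.sq_inv_sqrt_mul b
  -- `topForm Ω (cK)` is `6cλ` on `b` with `λ < 0`, so `c` must have the sign opposite to `σ`.
  refine ⟨(-(σ / |σ|) * (√(-hitchinScalar Ω.toAlternatingMap b))⁻¹) • hitchinMapL Ω b,
    (isComplexStr_and_isPureWrt_iff b hΩ).2 ⟨_, rfl, ?_⟩, ?_⟩
  · rw [mul_pow, neg_sq, div_pow, sq_abs, div_self (pow_ne_zero 2 hσ), one_mul, hc]
  · rw [topForm_smul_hitchinMapL]
    have h1 : 0 < (√(-hitchinScalar Ω.toAlternatingMap b))⁻¹ :=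
      inv_pos.2 (Real.sqrt_pos.2 (by linarith))
    have h2 : σ * (σ / |σ|) = |σ| := by
      rw [← mul_div_assoc, ← abs_mul_abs_self, mul_div_cancel_right₀ _ (abs_ne_zero.2 hσ)]
    have h3 := mul_pos (mul_pos (abs_pos.2 hσ) h1) (neg_pos.2 hl)
    rw [← h2] at h3
    nlinarith

end SignNormalisation

theorem IsPureWrt.neg {V : Type*} [AddCommGroup V] [Module ℝ V] [TopologicalSpace V]
    [IsTopologicalAddGroup V] {Ω : V [⋀^Fin 3]→L[ℝ] ℝ} {J : V →L[ℝ] V} (h : IsPureWrt Ω J) :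
    IsPureWrt Ω (-J) := by
  rw [isPureWrt_iff] at h ⊢
  have h1 := h.smul (-1)
  rwa [neg_one_smul] at h1

/-! ### Pure almost complex structures and orientations. -/

section AlmostComplex

variable {M : Type*} [TopologicalSpace M] [ChartedSpace R6 M] [IsManifold (𝓡 6) ∞ M]
  {Ω : ∀ x : M, TangentSpace (𝓡 6) x [⋀^Fin 3]→L[ℝ] ℝ}

theorem IsAlmostComplex.neg {J : ∀ x : M, TangentSpace (𝓡 6) x →L[ℝ] TangentSpace (𝓡 6) x}
    (hJ : IsAlmostComplex J) : IsAlmostComplex fun x => -J x := by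
  refine ⟨smoothEndOn_iff.2 fun x₀ hx₀ => ?_, fun x v => ?_⟩
  · have : endInCoord (fun x => -J x) x₀ = fun x => -endInCoord J x₀ x := by
      ext1 x
      simp only [endInCoord, ContinuousLinearMap.inCoordinates, ContinuousLinearMap.neg_comp,
        ContinuousLinearMap.comp_neg]
    rw [this]
    exact (smoothEndOn_iff.1 hJ.1 x₀ hx₀).neg
  · have := hJ.2 x v
    simp only [neg_apply, map_neg, neg_neg, this]

/-- The basis of the tangent space given by its identification with the model space. -/
def tangentBasis (x : M) : Basis (Fin 6) ℝ (TangentSpace (𝓡 6) x) := stdBasis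

theorem compContinuousLinearMap_stdBasis (η : R6 [⋀^Fin 6]→L[ℝ] ℝ) (g : R6 →L[ℝ] R6) :
    η.compContinuousLinearMap g stdBasis = g.det * η stdBasis := by
  have h1 := stdBasis.det_comp (g : R6 →ₗ[ℝ] R6) stdBasis
  rw [stdBasis.det_self, mul_one] at h1
  rw [mul_comm]
  exact (DFunLike.congr_fun (η.eq_smul_detL stdBasis) _).trans (congrArg (η stdBasis * ·) h1)

/-- `TangentSpace` at `x` is the model space through the preferred chart at `x`, so passing to the
trivialisation at `x₀` costs the Jacobian between the two preferred charts. -/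
theorem formInCoord_stdBasis (η : ∀ x : M, TangentSpace (𝓡 6) x [⋀^Fin 6]→L[ℝ] ℝ) (x₀ x : M)
    (hx : x ∈ (trivializationAt R6 (TangentSpace (𝓡 6) : M → Type _) x₀).baseSet) :
    formInCoord η x₀ x stdBasis =
      jacobianDet (chartAt R6 x₀) (chartAt R6 x) x * η x (tangentBasis x) := by
  rw [TangentBundle.trivializationAt_baseSet] at hx
  have h1 := TangentBundle.symmL_trivializationAt_eq_core (I := 𝓡 6) hx
  have h2 : (tangentBundleCore (𝓡 6) M).coordChange (achart R6 x₀) (achart R6 x) x =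
      fderiv ℝ (fun y : R6 => chartAt R6 x ((chartAt R6 x₀).symm y)) (chartAt R6 x₀ x) := by
    rw [tangentBundleCore_coordChange_achart]
    simp only [mfld_simps, fderivWithin_univ]
    rfl
  rw [h2] at h1
  rw [formInCoord, h1]
  exact compContinuousLinearMap_stdBasis (η x) _

theorem topForm_coordBasis (A : ∀ x : M, TangentSpace (𝓡 6) x →L[ℝ] TangentSpace (𝓡 6) x)
    (x₀ x : M)
    (hx : x ∈ (trivializationAt R6 (TangentSpace (𝓡 6) : M → Type _) x₀).baseSet) :
    topForm (Ω x).toAlternatingMap (A x : TangentSpace (𝓡 6) x →ₗ[ℝ] TangentSpace (𝓡 6) x)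
        (coordBasis x₀ x hx) =
      jacobianDet (chartAt R6 x₀) (chartAt R6 x) x *
        topForm (Ω x).toAlternatingMap (A x : TangentSpace (𝓡 6) x →ₗ[ℝ] TangentSpace (𝓡 6) x)
          (tangentBasis x) := by
  have h := formInCoord_stdBasis (fun x => topFormL (Ω x) (tangentBasis x) (A x)) x₀ x hx
  rw [formInCoord_apply _ x₀ x hx] at h
  have h1 := topFormL_apply (Ω := Ω x) (tangentBasis x) (A x) (coordBasis x₀ x hx)
  have h2 := topFormL_apply (Ω := Ω x) (tangentBasis x) (A x) (tangentBasis x)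
  rw [← h1, ← h2]
  exact h

/-- `topForm Ω J` is a smooth nowhere vanishing 6-form. Its coefficient in the chart at `x₀` is
continuous and keeps its sign near `x₀`. -/
theorem isOrientingFunction_of_almostComplex (hΩ : IsTypeTwoForm Ω)
    {J : ∀ x : M, TangentSpace (𝓡 6) x →L[ℝ] TangentSpace (𝓡 6) x} (hJ : IsAlmostComplex J)
    (hpure : ∀ x, IsPureWrt (Ω x) (J x)) :
    IsOrientingFunction fun x => topForm (Ω x).toAlternatingMap
      (J x : TangentSpace (𝓡 6) x →ₗ[ℝ] TangentSpace (𝓡 6) x) (tangentBasis x) := by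
  have hne (x : M) : topForm (Ω x).toAlternatingMap
      (J x : TangentSpace (𝓡 6) x →ₗ[ℝ] TangentSpace (𝓡 6) x) (tangentBasis x) ≠ 0 := by
    obtain ⟨c, hc, hc'⟩ := (isComplexStr_and_isPureWrt_iff (tangentBasis x) (hΩ.isTypeTwo x)).1
      ⟨hJ.2 x, hpure x⟩
    rw [hc, topForm_smul_hitchinMapL]
    intro h
    have : c * hitchinScalar (Ω x).toAlternatingMap (tangentBasis x) = 0 := by linarith
    rw [sq, mul_assoc, this] at hc'
    norm_num at hc'
  refine ⟨hne, fun x₀ => ?_⟩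
  have h1 := (contMDiffWithinAt_endInCoord_iff hΩ
    (fun x => Submodule.subset_span ⟨hJ.2 x, hpure x⟩) Set.univ x₀).1
    (smoothEndOn_iff.1 hJ.1 x₀ (Set.mem_univ x₀))
  rw [contMDiffWithinAt_univ] at h1
  have key (x : M)
      (hx : x ∈ (trivializationAt R6 (TangentSpace (𝓡 6) : M → Type _) x₀).baseSet) :=
    (topForm_inCoord_stdBasis (Ω := Ω) J x₀ x hx).trans (topForm_coordBasis J x₀ x hx)
  have h0 := key x₀ (FiberBundle.mem_baseSet_trivializationAt' x₀)
  rw [jacobianDet_self (mem_chart_source R6 x₀), one_mul] at h0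
  have h2 := (continuousAt_const.mul h1.continuousAt).eventually (lt_mem_nhds
    ((mul_self_pos.2 (hne x₀)).trans_eq (congrArg (topForm (Ω x₀).toAlternatingMap
      (J x₀ : TangentSpace (𝓡 6) x₀ →ₗ[ℝ] TangentSpace (𝓡 6) x₀) (tangentBasis x₀) * ·) h0.symm)))
  filter_upwards [h2, eventually_mem_baseSet x₀] with x h3 hx
  rw [Pi.mul_apply, key x hx] at h3
  refine h3.trans_eq ?_
  ring

theorem IsOrientingFunction.exists_almostComplex (hΩ : IsTypeTwoForm Ω) {s : M → ℝ}
    (hs : IsOrientingFunction s) :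
    ∃ J : ∀ x : M, TangentSpace (𝓡 6) x →L[ℝ] TangentSpace (𝓡 6) x,
      IsAlmostComplex J ∧ ∀ x, IsPureWrt (Ω x) (J x) := by
  choose J hJ hsign using fun x =>
    exists_pure_of_sign (tangentBasis x) (hΩ.isTypeTwo x) (hs.1 x)
  refine ⟨J, ⟨smoothEndOn_iff.2 fun x₀ _ => ?_, fun x => (hJ x).1⟩, fun x => (hJ x).2⟩
  have hΩ₀ : ContMDiffWithinAt (𝓡 6) 𝓘(ℝ, R6 [⋀^Fin 3]→L[ℝ] ℝ) ∞ (formInCoord Ω x₀)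
      Set.univ x₀ := hΩ.1 x₀ (Set.mem_univ _)
  have hK : ContMDiffWithinAt (𝓡 6) 𝓘(ℝ, R6 →L[ℝ] R6) ∞ (fun x =>
      hitchinMapL (formInCoord Ω x₀ x) stdBasis) Set.univ x₀ :=
    contDiff_hitchinMapL.contMDiff.contMDiffAt.comp_contMDiffWithinAt x₀ hΩ₀
  have hmem := FiberBundle.mem_baseSet_trivializationAt' (F := R6)
    (E := (TangentSpace (𝓡 6) : M → Type _)) x₀
  have hl := hitchinScalar_inCoord_neg hΩ x₀ x₀ hmem
  have hsqrt : ContDiffAt ℝ ∞ (fun Ω' : R6 [⋀^Fin 3]→L[ℝ] ℝ => -(s x₀ / |s x₀|) *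
      (√(-hitchinScalar Ω'.toAlternatingMap stdBasis))⁻¹) (formInCoord Ω x₀ x₀) := by
    refine contDiffAt_const.mul (ContDiffAt.inv (ContDiffAt.sqrt
      contDiff_hitchinScalar.neg.contDiffAt (by linarith)) ?_)
    exact (Real.sqrt_pos.2 (by linarith)).ne'
  have hc := hsqrt.contMDiffAt.comp_contMDiffWithinAt x₀ hΩ₀
  -- `J` is chosen pointwise, but near `x₀` the sign of its 6-form in this trivialisation is that of
  -- `s x₀`, which yields a smooth formula with a constant sign.
  have key : ∀ᶠ x in 𝓝 x₀, endInCoord J x₀ x = (-(s x₀ / |s x₀|) *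
      (√(-hitchinScalar (formInCoord Ω x₀ x).toAlternatingMap stdBasis))⁻¹) •
        hitchinMapL (formInCoord Ω x₀ x) stdBasis := by
    filter_upwards [hs.2 x₀, eventually_mem_baseSet x₀] with x h1 hx
    refine endInCoord_eq_smul hx ?_
    rw [hitchinScalar_inCoord x₀ x hx]
    refine pure_eq_of_sign _ (hΩ.isTypeTwo x) (hJ x) ?_
    rw [topForm_coordBasis J x₀ x hx]
    -- The factor `s(x)²` is what remains when the orienting condition is multiplied by the sign
    -- condition defining `J x`.
    refine pos_of_mul_pos_left ?_ (sq_nonneg (s x))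
    refine (mul_pos h1 (hsign x)).trans_eq ?_
    ring
  exact (hc.smul hK).congr_of_eventuallyEq (nhdsWithin_le_nhds key) key.self_of_nhds

end AlmostComplex

end

theorem mainTheorem6 {M : Type*} [TopologicalSpace M] [T2Space M] [SecondCountableTopology M]
    [ChartedSpace R6 M] [IsManifold (𝓡 6) ∞ M]
    (Ω : ∀ x : M, TangentSpace (𝓡 6) x [⋀^Fin 3]→L[ℝ] ℝ) (hΩ : IsTypeTwoForm Ω) :
    ((∃ Jp Jm : ∀ x : M, TangentSpace (𝓡 6) x →L[ℝ] TangentSpace (𝓡 6) x,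
        IsAlmostComplex Jp ∧ IsAlmostComplex Jm ∧
        (∀ x, Jp x + Jm x = 0) ∧
        (∀ x, IsPureWrt (Ω x) (Jp x)) ∧
        (∀ x, IsPureWrt (Ω x) (Jm x))) ↔
      IsOrientable M) ∧
    IsSmoothLineSubbundle (pureSpan Ω) ∧
    IsIsomorphicToTopForms (pureSpan Ω) := by
  refine ⟨⟨?_, fun h => ?_⟩, isSmoothLineSubbundle_pureSpan hΩ,
    isIsomorphicToTopForms_pureSpan hΩ⟩
  · rintro ⟨J, -, hJ, -, -, hpure, -⟩
    exact (isOrientingFunction_of_almostComplex hΩ hJ hpure).isOrientable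
  · obtain ⟨s, hs⟩ := exists_isOrientingFunction h
    obtain ⟨J, hJ, hpure⟩ := hs.exists_almostComplex hΩ
    exact ⟨J, fun x => -J x, hJ, hJ.neg, fun x => add_neg_cancel _, hpure,
      fun x => (hpure x).neg⟩
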